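/- Consider a binary cellular automaton (CA) on $\mathbb Z$ with finite neighborhood $\mathcal N\subset\mathbb Z$, local rule $\phi:\{0,1\}^{\mathcal N}\to\{0,1\}$ and global map $\Phi(\eta)(x)=\phi\big((\eta(x+v))_{v\in\mathcal N}\big)$. For $\xi_0=\eta$ put $\xi_{t}=\Phi^t(\eta)$; let $\xi_t^{(y)}$ be $\xi_t$ with the state at $y$ flipped, and for $\Delta_0:\mathbb Z\to\mathbb Z_+$, nonzero with finite support, let $$\Delta_{t+1}(x)=\sum_{y\in x+\mathcal N}\mathbf 1\big(\Phi(\xi_t^{(y)})(x)\neq\xi_{t+1}(x)\big)\,\Delta_t(y).$$ The Lyapunov profile is $$L(\alpha)=\lim_{\epsilon\downarrow0}\limsup_{t\to\infty}\frac1t\log\sum_{x:|x/t-\alpha|<\epsilon}\Delta_t(x)\in[-\infty,\infty),\qquad \log 0=-\infty,$$ and it is proper if replacing $\limsup$ by $\liminf$ gives the same $L(\alpha)$ for every $\alpha\in\mathbb R$. The maximal Lyapunov exponent (MLE) is $\max_\alpha L(\alpha)$, and an $\alpha$ at which the maximum is attained is an MLE direction. Let $\eta$ be doubly periodic, with (minimal)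 temporal period $\pi\ge1$, $\Phi^\pi(\eta)=\eta$, and (minimal) spatial period $\sigma\ge1$. Let $\pi_0\ge1$ be the smallest time for which there is a $\sigma_0\in\{0,\dots,\sigma-1\}$ with $(\Phi^{\pi_0}\eta)(x)=\eta(x-\sigma_0)$ for all $x$. Assume that $\eta$ is irreducible: the $\{0,1\}$-matrix $K$ on $\{0,\dots,\sigma-1\}$, with $K(a,b)=1$ iff $\Delta_0=\mathbf 1_{\{a\}}$ results in $\Delta_\pi(x)>0$ for some $x\equiv b\bmod\sigma$, is irreducible, that is, for all $a,b$ there is an $n\ge1$ with $K^n(a,b)>0$. The expansion graph has vertices $0,\dots,\sigma-1$. For every vertex $i$ and every $D\in\mathbb Z$ such that $\Delta_0=\mathbf 1_{\{i\}}$ gives $\Delta_{\pi_0}(i+D)\ne0$, it has an edge $e$ from $i$ to $(i+D-\sigma_0)\bmod\sigma$ with displacement label $D(e)=D$ and size label $N(e)=\Delta_{\pi_0}(i+D)$. Let $e_1,\dots,e_{d_T}$ be its edges. Let $T$ be the $d_T\times d_T$ matrix with $T_{k\ell}=N(e_k)$ if $e_k$ ends where $e_\ell$ starts and $T_{k\ell}=0$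 otherwise, let $W_y=\mathrm{diag}(e^{yD(e_k)})$ for $y\in\mathbb R$, and let $T'$ be the $\sigma\times\sigma$ matrix with $T'_{ij}=\sum N(e)$ over the edges $e$ from $i$ to $j$. Let $\mathrm{spr}$ be the spectral radius, $\Lambda(y)=\log\mathrm{spr}(T\,W_y)$ and $\lambda_1=\mathrm{spr}(T)$. Then $L$ is proper and does not depend on $\Delta_0$; $\mathrm{spr}(T\,W_y)>0$ for all $y$, and for every $\alpha\in\mathbb R$ $$L(\alpha)=\inf_{y\in\mathbb R}\Big(-y\alpha+\frac1{\pi_0}\Lambda(y)\Big).$$ Moreover $\lambda_1$ is an eigenvalue of $T$, and the MLE equals $\frac1{\pi_0}\log\mathrm{spr}(T')=\frac1{\pi_0}\log\lambda_1$, where $\mathrm{spr}(T')=\lambda_1$. Finally, for every $k$ the limit $$c_k=\lim_{n\to\infty}\frac1n\sum_{m=0}^{n-1}\frac{(T^m)_{kk}}{\lambda_1^m}$$ exists and is positive; if $T$ is primitive (some power of $T$ has only positive entries), then $(T^n)_{kk}\sim c_k\lambda_1^n$ as $n\to\infty$; and there is a unique MLE direction, namely $$\frac1{\pi_0}\sum_{k=1}^{d_T}c_kD(e_k).$$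 -/

import Mathlib

open Filter Topology
open scoped ENNReal

/-- A binary one-dimensional cellular automaton: a finite neighborhood `nbhd ⊂ ℤ` and a local update
function of the states on the neighborhood (indexed by the sites of the neighborhood). -/
structure BinaryCA where
  nbhd : Finset ℤ
  rule : (nbhd → Bool) → Bool

namespace BinaryCA

/-- The global function `Φ`. -/
def step (A : BinaryCA) (η : ℤ → Bool) : ℤ → Bool :=
  fun x => A.rule fun v => η (x + v)

/-- The perturbation of `η` at `y`. -/
def perturb (η : ℤ → Bool) (y : ℤ) : ℤ → Bool :=
  Function.update η y (!η y)

/-- The indicator that perturbing `η` at `y` changes the updated state at `x`. -/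
def change (A : BinaryCA) (η : ℤ → Bool) (y x : ℤ) : ℕ :=
  if A.step (perturb η y) x ≠ A.step η x then 1 else 0

/-- The defect configuration `Δ_t` of the defect accumulation dynamics started from the CA state
`η` and the defect configuration `Δ₀`. The sum is over the points `y = x + v` of the neighborhood
of `x`, and `A.step^[t] η` is the CA state at time `t`. -/
def defects (A : BinaryCA) (η : ℤ → Bool) (Δ₀ : ℤ → ℕ) : ℕ → ℤ → ℕ
  | 0 => Δ₀
  | t + 1 => fun x =>
      ∑ v ∈ A.nbhd, A.change (A.step^[t] η) (x + v) x * A.defects η Δ₀ t (x + v)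

/-- An admissible initial defect configuration: nonzero with finite support. -/
def IsInitialDefect (Δ₀ : ℤ → ℕ) : Prop :=
  Δ₀ ≠ 0 ∧ Δ₀.support.Finite

/-! ### Lyapunov profile -/

/-- `(1/t) log ∑_{x : |x/t - α| < ε} Δ_t(x)`, an extended real number, with `log 0 = -∞`. -/
noncomputable def growth (A : BinaryCA) (η : ℤ → Bool) (Δ₀ : ℤ → ℕ) (α ε : ℝ) (t : ℕ) : EReal :=
  ENNReal.log (∑' x : {x : ℤ // |(x : ℝ) / t - α| < ε}, (A.defects η Δ₀ t x : ℝ≥0∞)) / (t : EReal)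

/-- The Lyapunov profile `L(α) = lim_{ε ↓ 0} limsup_{t → ∞} (1/t) log ∑_{|x/t - α| < ε} Δ_t(x)`. -/
noncomputable def lyapunovProfile (A : BinaryCA) (η : ℤ → Bool) (Δ₀ : ℤ → ℕ) (α : ℝ) : EReal :=
  limUnder (𝓝[>] (0 : ℝ)) fun ε => limsup (A.growth η Δ₀ α ε) atTop

/-- The same as `lyapunovProfile`, with `liminf` in place of `limsup`. -/
noncomputable def lowerLyapunovProfile (A : BinaryCA) (η : ℤ → Bool) (Δ₀ : ℤ → ℕ) (α : ℝ) : EReal :=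
  limUnder (𝓝[>] (0 : ℝ)) fun ε => liminf (A.growth η Δ₀ α ε) atTop

/-- The Lyapunov profile is proper if replacing `limsup` by `liminf` does not change it. -/
def IsProper (A : BinaryCA) (η : ℤ → Bool) (Δ₀ : ℤ → ℕ) : Prop :=
  ∀ α : ℝ, A.lowerLyapunovProfile η Δ₀ α = A.lyapunovProfile η Δ₀ α

/-- `lam` is the maximal Lyapunov exponent: the maximum (attained) of the Lyapunov profile. -/
def IsMLE (A : BinaryCA) (η : ℤ → Bool) (Δ₀ : ℤ → ℕ) (lam : EReal) : Prop :=
  IsGreatest (Set.range (A.lyapunovProfile η Δ₀)) lam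

/-- `α` is an MLE direction: the Lyapunov profile attains its maximum at `α`. -/
def IsMLEDirection (A : BinaryCA) (η : ℤ → Bool) (Δ₀ : ℤ → ℕ) (α : ℝ) : Prop :=
  ∀ β : ℝ, A.lyapunovProfile η Δ₀ β ≤ A.lyapunovProfile η Δ₀ α

theorem growth_mono (A : BinaryCA) (η : ℤ → Bool) (Δ₀ : ℤ → ℕ) (α : ℝ) (t : ℕ) :
    Monotone fun ε => A.growth η Δ₀ α ε t := by
  intro ε ε' h
  refine EReal.div_le_div_right_of_nonneg (by positivity) (ENNReal.log_le_log ?_)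
  exact ENNReal.tsum_mono_subtype (fun x : ℤ => (A.defects η Δ₀ t x : ℝ≥0∞))
    (s := {x : ℤ | |(x : ℝ) / t - α| < ε}) (t := {x : ℤ | |(x : ℝ) / t - α| < ε'})
    fun x hx => lt_of_lt_of_le hx h

/-- The limit in the definition of the Lyapunov profile exists. -/
theorem tendsto_lyapunovProfile (A : BinaryCA) (η : ℤ → Bool) (Δ₀ : ℤ → ℕ) (α : ℝ) :
    Tendsto (fun ε => limsup (A.growth η Δ₀ α ε) atTop) (𝓝[>] (0 : ℝ))
      (𝓝 (A.lyapunovProfile η Δ₀ α)) :=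
  tendsto_nhds_limUnder ⟨_, Monotone.tendsto_nhdsGT (fun _ _ h =>
    limsup_le_limsup (Eventually.of_forall fun t => A.growth_mono η Δ₀ α t h)) 0⟩

/-- The limit in the definition of the lower Lyapunov profile exists. -/
theorem tendsto_lowerLyapunovProfile (A : BinaryCA) (η : ℤ → Bool) (Δ₀ : ℤ → ℕ) (α : ℝ) :
    Tendsto (fun ε => liminf (A.growth η Δ₀ α ε) atTop) (𝓝[>] (0 : ℝ))
      (𝓝 (A.lowerLyapunovProfile η Δ₀ α)) :=
  tendsto_nhds_limUnder ⟨_, Monotone.tendsto_nhdsGT (fun _ _ h =>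
    liminf_le_liminf (Eventually.of_forall fun t => A.growth_mono η Δ₀ α t h)) 0⟩

/-! ### Doubly periodic states -/

/-- `p` is the temporal period of `η`. -/
def IsTemporalPeriod (A : BinaryCA) (η : ℤ → Bool) (p : ℕ) : Prop :=
  IsLeast {q : ℕ | 1 ≤ q ∧ A.step^[q] η = η} p

/-- `σ` is the spatial period of `η`. -/
def IsSpatialPeriod (η : ℤ → Bool) (σ : ℕ) : Prop :=
  IsLeast {s : ℕ | 1 ≤ s ∧ ∀ x : ℤ, η x = η (x % s)} σ

/-- In `q` steps the CA shifts `η` to the right by `s`. -/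
def ShiftsBy (A : BinaryCA) (η : ℤ → Bool) (q s : ℕ) : Prop :=
  ∀ x : ℤ, A.step^[q] η x = η (x - s)

/-- `p₀` is the shift period of `η` (whose spatial period is `σ`) and `σ₀ ∈ {0, …, σ - 1}` is the
corresponding shift. -/
def IsShiftPeriod (A : BinaryCA) (η : ℤ → Bool) (σ p₀ σ₀ : ℕ) : Prop :=
  IsLeast {q : ℕ | 1 ≤ q ∧ ∃ s < σ, A.ShiftsBy η q s} p₀ ∧ σ₀ < σ ∧ A.ShiftsBy η p₀ σ₀

/-- The defect configuration at time `t`, started from a single defect at `i`. -/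
def defectsFrom (A : BinaryCA) (η : ℤ → Bool) (i : ℤ) (t : ℕ) : ℤ → ℕ :=
  A.defects η (Pi.single i 1) t

open Classical in
/-- The reduced kernel `K` (`p` is the temporal and `σ` the spatial period): `K(a,b) = 1` exactly
when a single defect at `a` results in a defect at time `p` at some `x` with `x ≡ b` modulo `σ`. -/
noncomputable def reducedKernel (A : BinaryCA) (η : ℤ → Bool) (p σ : ℕ) :
    Matrix (Fin σ) (Fin σ) ℝ :=
  Matrix.of fun a b =>
    if ∃ x : ℤ, x ≡ (b : ℕ) [ZMOD σ] ∧ 0 < A.defectsFrom η (a : ℕ) p x then 1 else 0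

/-! ### Expansion graph -/

/-- The edges of the expansion graph (`σ` is the spatial and `p₀` the shift period). Its vertices
are `0, …, σ - 1`. Each site `i + D` at which the configuration at time `p₀`, started from a single
defect at the vertex `i`, is nonzero gives an edge with source `i` and displacement label `D`. -/
@[ext]
structure Edge (A : BinaryCA) (η : ℤ → Bool) (σ p₀ : ℕ) where
  /-- the vertex from which the edge emanates -/
  source : Fin σ
  /-- the displacement label -/
  D : ℤ
  ne_zero : A.defectsFrom η (source : ℕ) p₀ ((source : ℕ) + D) ≠ 0

theorem defects_support_finite (A : BinaryCA) (η : ℤ → Bool) (Δ₀ : ℤ → ℕ)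
    (h : Δ₀.support.Finite) (t : ℕ) : (A.defects η Δ₀ t).support.Finite := by
  induction t with
  | zero => exact h
  | succ t ih =>
    refine (A.nbhd.finite_toSet.biUnion (t := fun v => (fun y => y - v) ''
      (A.defects η Δ₀ t).support) fun v _ => ih.image _).subset fun x hx => ?_
    obtain ⟨v, hv, hne⟩ := Finset.exists_ne_zero_of_sum_ne_zero hx
    simp only [Set.mem_iUnion]
    exact ⟨v, hv, x + v, right_ne_zero_of_mul hne, by simp⟩

instance (A : BinaryCA) (η : ℤ → Bool) (σ p₀ : ℕ) : Finite (A.Edge η σ p₀) := by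
  have hfin (i : Fin σ) : Finite {D : ℤ // A.defectsFrom η (i : ℕ) p₀ ((i : ℕ) + D) ≠ 0} := by
    have h : (A.defectsFrom η (i : ℕ) p₀).support.Finite :=
      A.defects_support_finite η _ ((Set.finite_singleton ((i : ℕ) : ℤ)).subset
        Pi.support_single_subset) p₀
    exact Set.Finite.to_subtype (h.preimage (add_right_injective ((i : ℕ) : ℤ)).injOn)
  refine Finite.of_injective
    (fun e : A.Edge η σ p₀ => (⟨e.source, e.D, e.ne_zero⟩ :
      Σ i : Fin σ, {D : ℤ // A.defectsFrom η (i : ℕ) p₀ ((i : ℕ) + D) ≠ 0})) ?_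
  rintro ⟨i, D, h⟩ ⟨i', D', h'⟩ heq
  obtain ⟨rfl, h2⟩ := Sigma.mk.inj_iff.mp heq
  obtain rfl := Subtype.mk.inj (eq_of_heq h2)
  rfl

noncomputable instance (A : BinaryCA) (η : ℤ → Bool) (σ p₀ : ℕ) : Fintype (A.Edge η σ p₀) :=
  Fintype.ofFinite _

noncomputable instance (A : BinaryCA) (η : ℤ → Bool) (σ p₀ : ℕ) : DecidableEq (A.Edge η σ p₀) :=
  Classical.decEq _

variable {A : BinaryCA} {η : ℤ → Bool} {σ p₀ : ℕ}

/-- The size label of an edge. -/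
def Edge.N (e : A.Edge η σ p₀) : ℕ :=
  A.defectsFrom η (e.source : ℕ) p₀ ((e.source : ℕ) + e.D)

/-- The edge `e` ends at the vertex `j`, that is, `j` is `i + D - σ₀` reduced modulo `σ`, where `i`
is the source of `e` and `D` its displacement label. -/
def Edge.EndsAt (e : A.Edge η σ p₀) (σ₀ : ℕ) (j : Fin σ) : Prop :=
  (e.source : ℕ) + e.D - σ₀ ≡ (j : ℕ) [ZMOD σ]

variable (A η σ p₀)

open Classical in
/-- The matrix `T`, indexed by the edges of the expansion graph. (The order of the edges plays no
role, so none is chosen.) -/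
noncomputable def edgeMatrix (σ₀ : ℕ) : Matrix (A.Edge η σ p₀) (A.Edge η σ p₀) ℝ :=
  Matrix.of fun k l => if k.EndsAt σ₀ l.source then (k.N : ℝ) else 0

/-- The weight matrix `W_y`. -/
noncomputable def weightMatrix (y : ℝ) : Matrix (A.Edge η σ p₀) (A.Edge η σ p₀) ℝ :=
  Matrix.diagonal fun k => Real.exp (y * k.D)

open Classical in
/-- The matrix `T'`, indexed by the vertices of the expansion graph. -/
noncomputable def vertexMatrix (σ₀ : ℕ) : Matrix (Fin σ) (Fin σ) ℝ :=
  Matrix.of fun i j => ∑ e : A.Edge η σ p₀, if e.source = i ∧ e.EndsAt σ₀ j then (e.N : ℝ) else 0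

/-- The spectral radius of a real square matrix: the largest modulus of a complex eigenvalue. -/
noncomputable def spr {n : Type*} [Fintype n] [DecidableEq n] (M : Matrix n n ℝ) : ℝ :=
  (spectralRadius ℂ (M.map (algebraMap ℝ ℂ))).toReal

/-- `Λ(y) = log spr (T · W_y)`. -/
noncomputable def logSpr (σ₀ : ℕ) (y : ℝ) : ℝ :=
  Real.log (spr (A.edgeMatrix η σ p₀ σ₀ * A.weightMatrix η σ p₀ y))

end BinaryCA

/-! The defect dynamics is linear in `Δ₀` and commutes with shifts, and after `p₀` steps the state
`η` has only been shifted by `σ₀`. If defects are weighted by `exp (y * displacement)`, the weights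
multiply along concatenated paths, so `p₀` steps act on functions of the residue modulo `σ` as one
nonnegative matrix, `tiltedMatrix`, with entries `∑ N e * exp (y * D e)`. Irreducibility of `K`
makes it irreducible. With `lam y` its Perron eigenvalue, the moment generating function of `Δ_t`
lies between constant multiples of `lam y ^ (t / p₀)` (`exists_mgf_bounds`), so its logarithm
divided by `t` tends to `G y = log (lam y) / p₀`.

The eigenvalue `lam` is differentiable because it is simple (`hasDerivAt_perron_eigenvalue`). A
Gärtner–Ellis argument then gives the profile: Chernoff's inequality bounds the `limsup` by `G y - y
* α` for every `y`, and exponential tilting bounds the `liminf` below by the infimum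
(`iInf_le_liminf_windowGrowth`). Hence the maximum of the profile is `G 0`, attained exactly at `G'
0`.

Perron vectors of the vertex matrix lift to Perron vectors of `T * W_y` with the same eigenvalue
(`isPerronPair_edgeMatrix`), which identifies the spectral radii. The `c k` are the diagonal entries
of the Perron projection of `T`, to which the powers of `T / lam 0` converge in mean. First-order
perturbation of `lam` at `0`, written edge by edge, gives `G' 0 = (∑ k, c k * D k) / p₀`. -/

namespace Matrix

/-! ### Perron–Frobenius theory: positive eigenvectors and simplicity. -/

variable {n : Type*} [Fintype n] {M : Matrix n n ℝ}

theorem pow_mulVec_eq [DecidableEq n] (M : Matrix n n ℝ) {lam : ℝ} {v : n → ℝ}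
    (hv : M *ᵥ v = lam • v) (k : ℕ) :
    (M ^ k) *ᵥ v = lam ^ k • v := by
  induction k with
  | zero => simp
  | succ k ih => rw [pow_succ, ← mulVec_mulVec, hv, mulVec_smul, ih, smul_smul, pow_succ, mul_comm]

/-- A substitute for a positive power, which a periodic irreducible matrix lacks: this sum commutes
with `M` and inherits its eigenvectors. -/
theorem IsIrreducible.exists_sum_pow_pos [DecidableEq n] (hM : M.IsIrreducible) :
    ∃ K : ℕ, ∀ i j, 0 < (∑ k ∈ Finset.range K, M ^ k) i j := by
  choose k hk hpos using (isIrreducible_iff_exists_pow_pos hM.nonneg).1 hM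
  refine ⟨∑ i, ∑ j, k i j + 1, fun i j => ?_⟩
  rw [sum_apply]
  refine Finset.sum_pos' (fun m _ => pow_apply_nonneg hM.nonneg m i j) ⟨k i j, ?_, hpos i j⟩
  rw [Finset.mem_range, Nat.lt_succ_iff]
  exact (Finset.single_le_sum (f := fun j => k i j) (fun _ _ => Nat.zero_le _)
    (Finset.mem_univ j)).trans (Finset.single_le_sum (f := fun i => ∑ j, k i j)
      (fun _ _ => Nat.zero_le _) (Finset.mem_univ i))

theorem mulVec_pos_of_pos {Z : Matrix n n ℝ} (hZ : ∀ i j, 0 < Z i j) {v : n → ℝ}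
    (hv : ∀ i, 0 ≤ v i) (hne : v ≠ 0) (i : n) : 0 < (Z *ᵥ v) i := by
  obtain ⟨j, hj⟩ := Function.ne_iff.1 hne
  exact Finset.sum_pos' (fun k _ => mul_nonneg (hZ i k).le (hv k))
    ⟨j, Finset.mem_univ j, mul_pos (hZ i j) ((hv j).lt_of_ne' hj)⟩

theorem mulVec_sum_pow_mulVec [DecidableEq n] (M : Matrix n n ℝ) (K : ℕ) (v : n → ℝ) :
    M *ᵥ ((∑ k ∈ Finset.range K, M ^ k) *ᵥ v) = (∑ k ∈ Finset.range K, M ^ k) *ᵥ (M *ᵥ v) := by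
  rw [mulVec_mulVec, mulVec_mulVec]
  congr 1
  exact (Commute.sum_right _ _ _ fun k _ => (Commute.refl M).pow_right k)

/-- Existence of a Perron eigenvector. -/
theorem IsIrreducible.exists_pos_eigenvector [DecidableEq n] [Nonempty n] (hM : M.IsIrreducible) :
    ∃ lam : ℝ, 0 < lam ∧ ∃ h : n → ℝ, (∀ i, 0 < h i) ∧ M *ᵥ h = lam • h := by
  obtain ⟨K, hK⟩ := hM.exists_sum_pow_pos
  set Z := ∑ k ∈ Finset.range K, M ^ k with hZ
  set R := ∑ i, ∑ j, M i j with hR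
  -- Collatz–Wielandt: the eigenvalue is the largest `lam` with `lam • x ≤ M *ᵥ x` for some `x` in
  -- the simplex. The bound `R` makes the set compact; summing coordinates shows that it excludes no
  -- such `lam`.
  let C : Set ((n → ℝ) × ℝ) :=
    (stdSimplex ℝ n ×ˢ Set.Icc 0 R) ∩ {q | ∀ i, q.2 * q.1 i ≤ (M *ᵥ q.1) i}
  have hCc : IsCompact C := by
    refine ((isCompact_stdSimplex ℝ n).prod isCompact_Icc).inter_right ?_
    simp only [Set.ofPred_forall]
    refine isClosed_iInter fun i => isClosed_le (by fun_prop) ?_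
    simp only [mulVec, dotProduct]
    fun_prop
  obtain ⟨x0, hx0⟩ : (stdSimplex ℝ n).Nonempty := by
    obtain ⟨i⟩ := ‹Nonempty n›
    exact ⟨_, single_mem_stdSimplex ℝ i⟩
  have hR0 : 0 ≤ R := Finset.sum_nonneg fun i _ => Finset.sum_nonneg fun j _ => hM.nonneg i j
  have hmv (v : n → ℝ) (hv : ∀ i, 0 ≤ v i) (i : n) : 0 ≤ (M *ᵥ v) i :=
    Finset.sum_nonneg fun j _ => mul_nonneg (hM.nonneg i j) (hv j)
  have hCne : C.Nonempty := ⟨(x0, 0), ⟨hx0, le_rfl, hR0⟩, fun i => by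
    simpa using hmv x0 hx0.1 i⟩
  obtain ⟨⟨x, lam⟩, ⟨⟨hx, hlam⟩, hle⟩, hmax⟩ := hCc.exists_isMaxOn hCne continuous_snd.continuousOn
  simp only [Set.mem_ofPred_eq] at hle hlam hx
  have hxne : x ≠ 0 := by
    rintro rfl
    simpa using hx.2
  have hZx := mulVec_pos_of_pos hK hx.1 hxne
  have heig : M *ᵥ x = lam • x := by
    -- Applying the positive matrix `Z` to the nonzero nonnegative gap makes every inequality
    -- strict, so `Z *ᵥ x`, normalized, would allow a larger `lam`.
    by_contra hne
    have hy : ∀ i, 0 < (Z *ᵥ (M *ᵥ x - lam • x)) i :=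
      mulVec_pos_of_pos hK (fun i => by simpa using hle i) (sub_ne_zero.2 hne)
    set z := Z *ᵥ x with hz
    have hMz : M *ᵥ z = Z *ᵥ (M *ᵥ x) := mulVec_sum_pow_mulVec M K x
    have hlt (i : n) : lam * z i < (M *ᵥ z) i := by
      have := hy i
      rw [mulVec_sub, mulVec_smul, ← hMz] at this
      simpa using this
    obtain ⟨i0, hi0⟩ := Finite.exists_min fun i => (M *ᵥ z) i / z i
    set r := (M *ᵥ z) i0 / z i0
    have hr : lam < r := by
      rw [lt_div_iff₀ (hZx i0)]
      exact hlt i0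
    have hrle (i : n) : r * z i ≤ (M *ᵥ z) i := (le_div_iff₀ (hZx i)).1 (hi0 i)
    set s := ∑ i, z i
    have hs : 0 < s := Finset.sum_pos (fun i _ => hZx i) Finset.univ_nonempty
    have hrR : r ≤ R := by
      have h1 : r * s ≤ R * s := by
        calc r * s = ∑ i, r * z i := Finset.mul_sum ..
          _ ≤ ∑ i, (M *ᵥ z) i := Finset.sum_le_sum fun i _ => hrle i
          _ ≤ ∑ i, ∑ j, M i j * s := by
            refine Finset.sum_le_sum fun i _ => Finset.sum_le_sum fun j _ => ?_
            exact mul_le_mul_of_nonneg_left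
              (Finset.single_le_sum (fun i _ => (hZx i).le) (Finset.mem_univ j)) (hM.nonneg i j)
          _ = R * s := by simp only [hR, Finset.sum_mul]
      exact le_of_mul_le_mul_right h1 hs
    have hmem : (s⁻¹ • z, r) ∈ C := by
      refine ⟨⟨⟨fun i => ?_, ?_⟩, hlam.1.trans hr.le, hrR⟩, fun i => ?_⟩
      · exact mul_nonneg (by positivity) (hZx i).le
      · simp [← Finset.mul_sum, s, hs.ne']
      · simp only [mulVec_smul, Pi.smul_apply, smul_eq_mul]
        have := mul_le_mul_of_nonneg_left (hrle i) (inv_nonneg.2 hs.le)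
        linarith
    exact absurd (hmax hmem) (not_le.2 hr)
  have hxpos (i : n) : 0 < x i := by
    have h1 : Z *ᵥ x = (∑ k ∈ Finset.range K, lam ^ k) • x := by
      rw [hZ, sum_mulVec, Finset.sum_smul]
      exact Finset.sum_congr rfl fun k _ => pow_mulVec_eq M heig k
    have h2 := hZx i
    rw [h1, Pi.smul_apply, smul_eq_mul] at h2
    exact (hx.1 i).lt_of_ne' (by rintro h; simp [h] at h2)
  refine ⟨lam, hlam.1.lt_of_ne' ?_, x, hxpos, heig⟩
  rintro rfl
  obtain ⟨i⟩ := ‹Nonempty n›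
  obtain ⟨k, hk, hpos⟩ := (isIrreducible_iff_exists_pow_pos hM.nonneg).1 hM i i
  have h0 : (M ^ k *ᵥ x) i = 0 := by
    rw [pow_mulVec_eq M heig, zero_pow hk.ne', zero_smul, Pi.zero_apply]
  have h1 : (M ^ k) i i * x i ≤ (M ^ k *ᵥ x) i :=
    Finset.single_le_sum (f := fun j => (M ^ k) i j * x j)
      (fun j _ => mul_nonneg (pow_apply_nonneg hM.nonneg k i j) (hx.1 j)) (Finset.mem_univ i)
  have := mul_pos hpos (hxpos i)
  linarith

theorem IsIrreducible.exists_pos_left_eigenvector [DecidableEq n] [Nonempty n]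
    (hM : M.IsIrreducible) :
    ∃ lam : ℝ, 0 < lam ∧ ∃ l : n → ℝ, (∀ i, 0 < l i) ∧ l ᵥ* M = lam • l := by
  obtain ⟨lam, h0, l, hl, h⟩ := hM.transpose.exists_pos_eigenvector
  exact ⟨lam, h0, l, hl, by rw [← h, mulVec_transpose]⟩

theorem dotProduct_pos_of_pos [Nonempty n] {l h : n → ℝ} (hl : ∀ i, 0 < l i) (hh : ∀ i, 0 < h i) :
    0 < l ⬝ᵥ h :=
  Finset.sum_pos (fun i _ => mul_pos (hl i) (hh i)) Finset.univ_nonempty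

/-- Evaluate `l ⬝ᵥ (M *ᵥ h)` from both sides. -/
theorem eigenvalue_eq_of_dotProduct_ne_zero {l h : n → ℝ} {lam mu : ℝ} (hne : l ⬝ᵥ h ≠ 0)
    (hl : l ᵥ* M = lam • l) (hh : M *ᵥ h = mu • h) : mu = lam := by
  have h1 : l ⬝ᵥ (M *ᵥ h) = (l ᵥ* M) ⬝ᵥ h := dotProduct_mulVec l M h
  rw [hl, hh, dotProduct_smul, smul_dotProduct, smul_eq_mul, smul_eq_mul] at h1
  exact mul_right_cancel₀ hne h1

/-- A Perron pair: positive right and left eigenvectors for the same eigenvalue. -/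
structure IsPerronPair (M : Matrix n n ℝ) (lam : ℝ) (h l : n → ℝ) : Prop where
  pos : 0 < lam
  right_pos : ∀ i, 0 < h i
  left_pos : ∀ i, 0 < l i
  right : M *ᵥ h = lam • h
  left : l ᵥ* M = lam • l

theorem IsIrreducible.exists_isPerronPair [DecidableEq n] [Nonempty n] (hM : M.IsIrreducible) :
    ∃ lam h l, M.IsPerronPair lam h l := by
  obtain ⟨lam, h0, h, hh, hr⟩ := hM.exists_pos_eigenvector
  obtain ⟨mu, _, l, hl, hl'⟩ := hM.exists_pos_left_eigenvector
  obtain rfl := eigenvalue_eq_of_dotProduct_ne_zero (dotProduct_pos_of_pos hl hh).ne' hl' hr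
  exact ⟨lam, h, l, h0, hh, hl, hr, hl'⟩

variable {lam : ℝ} {h l : n → ℝ}

theorem pow_vecMul_eq [DecidableEq n] (M : Matrix n n ℝ)
    {v : n → ℝ} (hv : v ᵥ* M = lam • v) (k : ℕ) :
    v ᵥ* (M ^ k) = lam ^ k • v := by
  rw [← mulVec_transpose, transpose_pow]
  exact pow_mulVec_eq _ (by rw [mulVec_transpose, hv]) k

/-- A positive matrix contracts the hyperplane orthogonal to a positive left eigenvector. -/
theorem exists_contraction [Nonempty n] {Z : Matrix n n ℝ} (hZ : ∀ i j, 0 < Z i j) {kap : ℝ}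
    (hl : ∀ i, 0 < l i) (hlZ : l ᵥ* Z = kap • l) :
    ∃ r, 0 ≤ r ∧ r < kap ∧ ∀ w : n → ℝ, l ⬝ᵥ w = 0 →
      ∑ i, l i * |(Z *ᵥ w) i| ≤ r * ∑ i, l i * |w i| := by
  -- Doeblin's argument: `d` is the largest constant for which `Z i j - d * l j` stays nonnegative.
  -- The subtracted rank-one matrix vanishes on the hyperplane `l ⬝ᵥ w = 0`, and the `l`-weighted
  -- norm then contracts by `kap - d * ∑ i, l i`.
  obtain ⟨q, hq⟩ := Finite.exists_min fun q : n × n => Z q.1 q.2 / l q.2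
  set d := Z q.1 q.2 / l q.2
  have hd : 0 < d := div_pos (hZ _ _) (hl _)
  have hdle (i j : n) : d * l j ≤ Z i j := (le_div_iff₀ (hl j)).1 (hq (i, j))
  have hs : 0 < ∑ i, l i := Finset.sum_pos (fun i _ => hl i) Finset.univ_nonempty
  have hcol (j : n) : ∑ i, l i * Z i j = kap * l j := congrFun hlZ j
  refine ⟨kap - d * ∑ i, l i, ?_, by nlinarith [mul_pos hd hs], fun w hw => ?_⟩
  · obtain ⟨j⟩ := ‹Nonempty n›
    have : d * (∑ i, l i) * l j ≤ kap * l j := by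
      rw [← hcol, Finset.mul_sum, Finset.sum_mul]
      exact Finset.sum_le_sum fun i _ => by nlinarith [hdle i j, hl i]
    linarith [le_of_mul_le_mul_right this (hl j)]
  · have h1 (i : n) : |(Z *ᵥ w) i| ≤ ∑ j, (Z i j - d * l j) * |w j| := by
      have : (Z *ᵥ w) i = ∑ j, (Z i j - d * l j) * w j := by
        simp only [sub_mul, Finset.sum_sub_distrib, mul_assoc, ← Finset.mul_sum]
        rw [show ∑ j, l j * w j = 0 from hw, mul_zero, sub_zero]
        rfl
      rw [this]
      refine (Finset.abs_sum_le_sum_abs _ _).trans (le_of_eq (Finset.sum_congr rfl fun j _ => ?_))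
      rw [abs_mul, abs_of_nonneg (sub_nonneg.2 (hdle i j))]
    calc ∑ i, l i * |(Z *ᵥ w) i| ≤ ∑ i, l i * ∑ j, (Z i j - d * l j) * |w j| :=
          Finset.sum_le_sum fun i _ => mul_le_mul_of_nonneg_left (h1 i) (hl i).le
      _ = ∑ j, (∑ i, l i * Z i j - d * l j * ∑ i, l i) * |w j| := by
          simp only [Finset.mul_sum]
          rw [Finset.sum_comm]
          refine Finset.sum_congr rfl fun j _ => ?_
          rw [← Finset.sum_sub_distrib, Finset.sum_mul]
          exact Finset.sum_congr rfl fun i _ => by ring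
      _ = (kap - d * ∑ i, l i) * ∑ i, l i * |w i| := by
          rw [Finset.mul_sum]
          exact Finset.sum_congr rfl fun j _ => by rw [hcol]; ring

/-- Simplicity of the Perron eigenvalue: the sum of powers multiplies `w` by exactly `kap`, whereas
on this hyperplane it shrinks the weighted norm by a factor `r < kap`. -/
theorem IsPerronPair.eq_zero_of_dotProduct_eq_zero [DecidableEq n] [Nonempty n]
    (hP : M.IsPerronPair lam h l)
    (hM : M.IsIrreducible) {w : n → ℝ} (hw : M *ᵥ w = lam • w) (hlw : l ⬝ᵥ w = 0) : w = 0 := by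
  obtain ⟨K, hK⟩ := hM.exists_sum_pow_pos
  set kap := ∑ k ∈ Finset.range K, lam ^ k
  have hl : l ᵥ* (∑ k ∈ Finset.range K, M ^ k) = kap • l := by
    rw [vecMul_sum, Finset.sum_smul]
    exact Finset.sum_congr rfl fun k _ => pow_vecMul_eq M hP.left k
  have hr : (∑ k ∈ Finset.range K, M ^ k) *ᵥ w = kap • w := by
    rw [sum_mulVec, Finset.sum_smul]
    exact Finset.sum_congr rfl fun k _ => pow_mulVec_eq M hw k
  obtain ⟨r, hr0, hrk, hc⟩ := exists_contraction hK hP.left_pos hl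
  have h1 := hc w hlw
  have h2 : ∑ i, l i * |((∑ k ∈ Finset.range K, M ^ k) *ᵥ w) i| = kap * ∑ i, l i * |w i| := by
    rw [hr, Finset.mul_sum]
    refine Finset.sum_congr rfl fun i _ => ?_
    rw [Pi.smul_apply, smul_eq_mul, abs_mul, abs_of_pos (hr0.trans_lt hrk)]
    ring
  have h3 (i : n) : 0 ≤ l i * |w i| := mul_nonneg (hP.left_pos i).le (abs_nonneg _)
  have h4 : ∑ i, l i * |w i| = 0 := by
    have := Finset.sum_nonneg fun i (_ : i ∈ Finset.univ) => h3 i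
    nlinarith
  funext i
  have h5 := (Finset.sum_eq_zero_iff_of_nonneg fun i _ => h3 i).1 h4 i (Finset.mem_univ i)
  simpa [(hP.left_pos i).ne'] using h5

theorem IsPerronPair.eigenvector_eq_smul [DecidableEq n] [Nonempty n] (hP : M.IsPerronPair lam h l)
    (hM : M.IsIrreducible) {v : n → ℝ} (hv : M *ᵥ v = lam • v) :
    v = (l ⬝ᵥ v / l ⬝ᵥ h) • h := by
  refine sub_eq_zero.1 (hP.eq_zero_of_dotProduct_eq_zero hM ?_ ?_)
  · rw [mulVec_sub, mulVec_smul, hv, hP.right, smul_sub, smul_comm]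
  · rw [dotProduct_sub, dotProduct_smul, smul_eq_mul,
      div_mul_cancel₀ _ (dotProduct_pos_of_pos hP.left_pos hP.right_pos).ne', sub_self]

theorem IsPerronPair.dotProduct_sub_eq_zero [Nonempty n] (hP : M.IsPerronPair lam h l)
    (v : n → ℝ) : l ⬝ᵥ (v - (l ⬝ᵥ v / l ⬝ᵥ h) • h) = 0 := by
  rw [dotProduct_sub, dotProduct_smul, smul_eq_mul,
    div_mul_cancel₀ _ (dotProduct_pos_of_pos hP.left_pos hP.right_pos).ne', sub_self]

end Matrix

/-! ### Spectral radius, asymptotics of powers and perturbation of the Perron eigenvalue. -/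

namespace Matrix

variable {n : Type*} [Fintype n] [DecidableEq n] {M : Matrix n n ℝ} {lam : ℝ} {h l : n → ℝ}

theorem mem_spectrum_of_mulVec_eq {K : Type*} [Field K] {M : Matrix n n K} {v : n → K} {mu : K}
    (hv : v ≠ 0) (h : M *ᵥ v = mu • v) : mu ∈ spectrum K M := by
  rw [← spectrum_toLin']
  exact (Module.End.hasEigenvalue_of_hasEigenvector
    ⟨Module.End.mem_eigenspace_iff.2 (by simpa using h), hv⟩).mem_spectrum

theorem exists_mulVec_eq_of_mem_spectrum {K : Type*} [Field K] {M : Matrix n n K} {mu : K}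
    (h : mu ∈ spectrum K M) : ∃ v : n → K, v ≠ 0 ∧ M *ᵥ v = mu • v := by
  rw [← spectrum_toLin', ← Module.End.hasEigenvalue_iff_mem_spectrum] at h
  obtain ⟨v, hv⟩ := h.exists_hasEigenvector
  exact ⟨v, hv.2, by simpa using Module.End.mem_eigenspace_iff.1 hv.1⟩

theorem mem_spectrum_of_pos_eigenvector [Nonempty n] (hh : ∀ i, 0 < h i)
    (hr : M *ᵥ h = lam • h) : lam ∈ spectrum ℝ M := by
  refine mem_spectrum_of_mulVec_eq ?_ hr
  rintro rfl
  exact (Classical.arbitrary n |> hh).ne rfl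

/-- A nonnegative matrix with a positive eigenvector has the corresponding eigenvalue as its
spectral radius. -/
theorem spr_eq_of_pos_eigenvector [Nonempty n] (hM : ∀ i j, 0 ≤ M i j) (hlam : 0 ≤ lam)
    (hh : ∀ i, 0 < h i) (hr : M *ᵥ h = lam • h) : BinaryCA.spr M = lam := by
  have key : spectralRadius ℂ (M.map (algebraMap ℝ ℂ)) = ENNReal.ofReal lam := by
    refine le_antisymm (iSup₂_le fun mu hmu => ?_) ?_
    · obtain ⟨v, hv, hmv⟩ := exists_mulVec_eq_of_mem_spectrum hmu
      -- In the row where `‖v i‖ / h i` is maximal, the eigenvalue equation for `v` is dominated by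
      -- that for `h`, whence `‖mu‖ ≤ lam`.
      obtain ⟨i, hi⟩ := Finite.exists_max fun i => ‖v i‖ / h i
      set m := ‖v i‖ / h i
      have hle (j : n) : ‖v j‖ ≤ m * h j := (div_le_iff₀ (hh j)).1 (hi j)
      have hvi : ‖v i‖ = m * h i := (div_mul_cancel₀ _ (hh i).ne').symm
      have hm : 0 < m := by
        obtain ⟨j, hj⟩ := Function.ne_iff.1 hv
        have h1 : 0 < ‖v j‖ := norm_pos_iff.2 hj
        exact (div_pos h1 (hh j)).trans_le (hi j)
      have h2 : ‖mu‖ * ‖v i‖ ≤ lam * ‖v i‖ := by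
        have h3 : mu * v i = ∑ j, ((M i j : ℝ) : ℂ) * v j := (congrFun hmv i).symm
        have h4 : ∑ j, M i j * h j = lam * h i := congrFun hr i
        calc ‖mu‖ * ‖v i‖ = ‖∑ j, ((M i j : ℝ) : ℂ) * v j‖ := by rw [← h3, norm_mul]
          _ ≤ ∑ j, M i j * (m * h j) := by
            refine (norm_sum_le _ _).trans (Finset.sum_le_sum fun j _ => ?_)
            rw [norm_mul, Complex.norm_real, Real.norm_of_nonneg (hM i j)]
            exact mul_le_mul_of_nonneg_left (hle j) (hM i j)
          _ = m * ∑ j, M i j * h j := by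
            rw [Finset.mul_sum]
            exact Finset.sum_congr rfl fun j _ => by ring
          _ = lam * ‖v i‖ := by rw [h4, hvi]; ring
      have h5 : ‖mu‖ ≤ lam := le_of_mul_le_mul_right h2 (by rw [hvi]; exact mul_pos hm (hh i))
      rw [← enorm_eq_nnnorm, ← ofReal_norm]
      exact ENNReal.ofReal_le_ofReal h5
    · have hmem : (lam : ℂ) ∈ spectrum ℂ (M.map (algebraMap ℝ ℂ)) := by
        refine mem_spectrum_of_mulVec_eq (v := fun i => (h i : ℂ)) ?_ ?_
        · intro h0
          have := congrFun h0 (Classical.arbitrary n)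
          exact (hh _).ne' (by simpa using this)
        · funext i
          have h4 : ∑ j, M i j * h j = lam * h i := congrFun hr i
          simp only [mulVec, dotProduct, map_apply, Pi.smul_apply, smul_eq_mul,
            Complex.coe_algebraMap]
          exact_mod_cast h4
      have : ENNReal.ofReal lam = (‖(lam : ℂ)‖₊ : ℝ≥0∞) := by
        rw [← enorm_eq_nnnorm, ← ofReal_norm, Complex.norm_real, Real.norm_of_nonneg hlam]
      rw [this]
      exact le_iSup₂ (f := fun k (_ : k ∈ spectrum ℂ (M.map (algebraMap ℝ ℂ))) =>
        (‖k‖₊ : ℝ≥0∞)) _ hmem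
  rw [BinaryCA.spr, key, ENNReal.toReal_ofReal hlam]

theorem IsPerronPair.spr_eq [Nonempty n] (hP : M.IsPerronPair lam h l) (hM : ∀ i j, 0 ≤ M i j) :
    BinaryCA.spr M = lam :=
  spr_eq_of_pos_eigenvector hM hP.pos.le hP.right_pos hP.right

theorem IsPerronPair.pow_apply_le (hP : M.IsPerronPair lam h l) (hM : ∀ i j, 0 ≤ M i j)
    (k : ℕ) (i j : n) : (M ^ k) i j / lam ^ k ≤ h i / h j := by
  rw [div_le_div_iff₀ (pow_pos hP.pos k) (hP.right_pos j)]
  have h1 : (M ^ k) i j * h j ≤ ((M ^ k) *ᵥ h) i :=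
    Finset.single_le_sum (f := fun j => (M ^ k) i j * h j)
      (fun j _ => mul_nonneg (pow_apply_nonneg hM k i j) (hP.right_pos j).le) (Finset.mem_univ j)
  rw [pow_mulVec_eq M hP.right, Pi.smul_apply, smul_eq_mul] at h1
  linarith

/-- For an irreducible matrix, the hyperplane orthogonal to the left Perron eigenvector is the range
of `lam - M`. -/
theorem IsPerronPair.exists_sub_mulVec [Nonempty n] (hP : M.IsPerronPair lam h l)
    (hM : M.IsIrreducible) {w : n → ℝ} (hw : l ⬝ᵥ w = 0) :
    ∃ u : n → ℝ, lam • u - M *ᵥ u = w := by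
  have hlh := dotProduct_pos_of_pos hP.left_pos hP.right_pos
  have happ (f : n → ℝ) : l ⬝ᵥ (lam • f - M *ᵥ f) = 0 := by
    rw [dotProduct_sub, dotProduct_mulVec, hP.left, dotProduct_smul, smul_dotProduct, sub_self]
  -- The rank-one term makes `lam - M` injective, hence surjective. Since `l ⬝ᵥ G f` is a nonzero
  -- multiple of `l ⬝ᵥ f`, the preimage of `w` is again orthogonal to `l`, and there the extra term
  -- vanishes.
  let G : (n → ℝ) →ₗ[ℝ] (n → ℝ) :=
    { toFun := fun f => (lam • f - M *ᵥ f) + (l ⬝ᵥ f) • h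
      map_add' := fun f g => by
        simp only [smul_add, mulVec_add, dotProduct_add, add_smul]
        abel
      map_smul' := fun c f => by
        simp only [mulVec_smul, dotProduct_smul, smul_eq_mul, mul_smul, smul_add, smul_sub,
          RingHom.id_apply]
        rw [smul_comm] }
  have hG (f : n → ℝ) : l ⬝ᵥ G f = (l ⬝ᵥ f) * (l ⬝ᵥ h) := by
    change l ⬝ᵥ ((lam • f - M *ᵥ f) + (l ⬝ᵥ f) • h) = _
    rw [dotProduct_add, happ, zero_add, dotProduct_smul, smul_eq_mul]
  have hdot {f : n → ℝ} (hf : l ⬝ᵥ G f = 0) : l ⬝ᵥ f = 0 := by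
    rw [hG] at hf
    exact (mul_eq_zero.1 hf).resolve_right hlh.ne'
  have hGeq {f : n → ℝ} (hf : l ⬝ᵥ f = 0) : G f = lam • f - M *ᵥ f := by
    change (lam • f - M *ᵥ f) + (l ⬝ᵥ f) • h = _
    rw [hf, zero_smul, add_zero]
  have hinj : Function.Injective G := by
    rw [← LinearMap.ker_eq_bot, LinearMap.ker_eq_bot']
    intro f hf
    have h1 : l ⬝ᵥ f = 0 := hdot (by rw [hf, dotProduct_zero])
    rw [hGeq h1] at hf
    exact hP.eq_zero_of_dotProduct_eq_zero hM (sub_eq_zero.1 hf).symm h1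
  obtain ⟨u, rfl⟩ := (LinearMap.injective_iff_surjective.1 hinj) w
  exact ⟨u, (hGeq (hdot hw)).symm⟩

theorem mulVec_single_one_eq (M : Matrix n n ℝ) (i j : n) : (M *ᵥ Pi.single j 1) i = M i j := by
  simp

/-- Mean convergence of the normalized powers of an irreducible matrix. -/
theorem IsPerronPair.tendsto_cesaro [Nonempty n] (hP : M.IsPerronPair lam h l)
    (hM : M.IsIrreducible) (i j : n) :
    Tendsto (fun N : ℕ => (∑ m ∈ Finset.range N, (M ^ m) i j / lam ^ m) / (N : ℝ)) atTop
      (𝓝 (h i * l j / l ⬝ᵥ h)) := by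
  have hlh := dotProduct_pos_of_pos hP.left_pos hP.right_pos
  have hlam := hP.pos
  obtain ⟨u, hu⟩ := hP.exists_sub_mulVec hM (hP.dotProduct_sub_eq_zero (Pi.single j 1))
  have hlj : l ⬝ᵥ Pi.single j 1 = l j := by simp
  rw [hlj] at hu
  set c := l j / l ⬝ᵥ h with hc
  -- The basis vector at `j` is `c • h` plus an element of the range of `lam - M`. The first part
  -- contributes a constant, the second telescopes to a bounded quantity.
  have hpow (m : ℕ) : (M ^ m) i j / lam ^ m =
      c * h i + lam * (((M ^ m) *ᵥ u) i / lam ^ m - ((M ^ (m + 1)) *ᵥ u) i / lam ^ (m + 1)) := by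
    have h1 : (Pi.single j 1 : n → ℝ) = c • h + (lam • u - M *ᵥ u) := by rw [hu]; abel
    have h2 : (M ^ m) i j = c * (lam ^ m * h i) + (lam * ((M ^ m) *ᵥ u) i
        - ((M ^ (m + 1)) *ᵥ u) i) := by
      rw [← mulVec_single_one_eq (M ^ m) i j, h1, mulVec_add, mulVec_smul, mulVec_sub, mulVec_smul,
        mulVec_mulVec, ← pow_succ, pow_mulVec_eq M hP.right]
      simp
    rw [h2, pow_succ lam m]
    field_simp
  have hsum (N : ℕ) (hN : N ≠ 0) : (∑ m ∈ Finset.range N, (M ^ m) i j / lam ^ m) / (N : ℝ) =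
      c * h i + (lam * (u i - ((M ^ N) *ᵥ u) i / lam ^ N)) * (N : ℝ)⁻¹ := by
    rw [Finset.sum_congr rfl fun m _ => hpow m, Finset.sum_add_distrib, ← Finset.mul_sum _ _ lam,
      Finset.sum_range_sub' (fun m => ((M ^ m) *ᵥ u) i / lam ^ m)]
    have : (N : ℝ) ≠ 0 := Nat.cast_ne_zero.2 hN
    simp
    field_simp
  have hbdd (N : ℕ) : ‖lam * (u i - ((M ^ N) *ᵥ u) i / lam ^ N)‖
      ≤ lam * (|u i| + ∑ k, h i / h k * |u k|) := by
    rw [norm_mul, Real.norm_of_nonneg hlam.le]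
    refine mul_le_mul_of_nonneg_left ((norm_sub_le _ _).trans (add_le_add le_rfl ?_)) hlam.le
    simp only [mulVec, dotProduct, Finset.sum_div]
    refine (norm_sum_le _ _).trans (Finset.sum_le_sum fun k _ => ?_)
    rw [mul_div_right_comm, norm_mul, Real.norm_of_nonneg
      (div_nonneg (pow_apply_nonneg hM.nonneg N i k) (by positivity))]
    exact mul_le_mul_of_nonneg_right (hP.pow_apply_le hM.nonneg N i k) (abs_nonneg _)
  have hlim : Tendsto (fun N : ℕ => c * h i +
      (lam * (u i - ((M ^ N) *ᵥ u) i / lam ^ N)) * (N : ℝ)⁻¹) atTop (𝓝 (c * h i + 0)) := by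
    refine tendsto_const_nhds.add ?_
    exact isBoundedUnder_le_mul_tendsto_zero (isBoundedUnder_of ⟨_, hbdd⟩)
      tendsto_inv_atTop_nhds_zero_nat
  rw [add_zero] at hlim
  rw [mul_div_assoc, ← hc, mul_comm]
  refine hlim.congr' ?_
  filter_upwards [eventually_ne_atTop 0] with N hN
  exact (hsum N hN).symm

/-- Convergence of the normalized powers of a primitive matrix. -/
theorem IsPerronPair.tendsto_pow [Nonempty n] (hP : M.IsPerronPair lam h l)
    (hM : M.IsPrimitive) (i j : n) :
    Tendsto (fun m : ℕ => (M ^ m) i j / lam ^ m) atTop (𝓝 (h i * l j / l ⬝ᵥ h)) := by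
  obtain ⟨N, hN, hpos⟩ := hM.exists_pos_pow
  have hlam := hP.pos
  obtain ⟨r, hr0, hrk, hc⟩ := exists_contraction hpos hP.left_pos (pow_vecMul_eq M hP.left N)
  set w := Pi.single j 1 - (l ⬝ᵥ Pi.single j 1 / l ⬝ᵥ h) • h with hw
  have hlw : l ⬝ᵥ w = 0 := hP.dotProduct_sub_eq_zero _
  have hlj : l ⬝ᵥ Pi.single j 1 = l j := by simp
  have hlM (m : ℕ) : l ⬝ᵥ ((M ^ m) *ᵥ w) = 0 := by
    rw [dotProduct_mulVec, pow_vecMul_eq M hP.left, smul_dotProduct, hlw, smul_zero]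
  -- In this norm a single step never expands, because `l` is a left eigenvector, and every `N`
  -- steps contract by `r / lam ^ N < 1`.
  let f : ℕ → ℝ := fun m => (∑ i, l i * |((M ^ m) *ᵥ w) i|) / lam ^ m
  have hf0 (m : ℕ) : 0 ≤ f m := div_nonneg (Finset.sum_nonneg fun i _ =>
    mul_nonneg (hP.left_pos i).le (abs_nonneg _)) (by positivity)
  have hanti : Antitone f := by
    refine antitone_nat_of_succ_le fun m => ?_
    have h1 : ∑ i, l i * |((M ^ (m + 1)) *ᵥ w) i| ≤ lam * ∑ i, l i * |((M ^ m) *ᵥ w) i| := by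
      calc ∑ i, l i * |((M ^ (m + 1)) *ᵥ w) i|
          ≤ ∑ i, l i * ∑ k, M i k * |((M ^ m) *ᵥ w) k| := by
            refine Finset.sum_le_sum fun i _ => mul_le_mul_of_nonneg_left ?_ (hP.left_pos i).le
            rw [pow_succ', ← mulVec_mulVec]
            refine (Finset.abs_sum_le_sum_abs _ _).trans (le_of_eq ?_)
            exact Finset.sum_congr rfl fun k _ => by rw [abs_mul, abs_of_nonneg (hM.nonneg i k)]
        _ = l ⬝ᵥ (M *ᵥ fun k => |((M ^ m) *ᵥ w) k|) := rfl
        _ = lam * ∑ i, l i * |((M ^ m) *ᵥ w) i| := by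
            rw [dotProduct_mulVec, hP.left, smul_dotProduct]
            rfl
    change _ / _ ≤ _ / _
    rw [pow_succ lam, div_le_div_iff₀ (by positivity) (by positivity)]
    nlinarith [pow_pos hlam m]
  have hgeom (k : ℕ) : f (N * k) ≤ (r / lam ^ N) ^ k * f 0 := by
    induction k with
    | zero => simp
    | succ k ih =>
      have h1 := hc _ (hlM (N * k))
      rw [mulVec_mulVec, ← pow_add] at h1
      have h2 : f (N * (k + 1)) ≤ r / lam ^ N * f (N * k) := by
        change _ / _ ≤ r / lam ^ N * (_ / _)
        rw [div_mul_div_comm, ← pow_add, mul_add, mul_one, add_comm (N * k)]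
        exact div_le_div_of_nonneg_right h1 (by positivity)
      calc f (N * (k + 1)) ≤ r / lam ^ N * f (N * k) := h2
        _ ≤ r / lam ^ N * ((r / lam ^ N) ^ k * f 0) :=
          mul_le_mul_of_nonneg_left ih (by positivity)
        _ = (r / lam ^ N) ^ (k + 1) * f 0 := by ring
  have hf : Tendsto f atTop (𝓝 0) := by
    have hq : r / lam ^ N < 1 := (div_lt_one (by positivity)).2 hrk
    have h1 : Tendsto (fun m : ℕ => (r / lam ^ N) ^ (m / N) * f 0) atTop (𝓝 (0 * f 0)) :=
      ((tendsto_pow_atTop_nhds_zero_of_lt_one (by positivity) hq).comp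
        (Nat.tendsto_div_const_atTop hN.ne')).mul_const _
    rw [zero_mul] at h1
    exact squeeze_zero hf0 (fun m => (hanti (Nat.mul_div_le m N)).trans (hgeom _)) h1
  have hwi : Tendsto (fun m : ℕ => ((M ^ m) *ᵥ w) i / lam ^ m) atTop (𝓝 0) := by
    have h1 := hf.mul_const (l i)⁻¹
    rw [zero_mul] at h1
    refine squeeze_zero_norm (fun m => ?_) h1
    rw [norm_div, Real.norm_of_nonneg (pow_pos hlam m).le, Real.norm_eq_abs]
    have h2 : l i * |((M ^ m) *ᵥ w) i| ≤ ∑ i, l i * |((M ^ m) *ᵥ w) i| :=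
      Finset.single_le_sum (f := fun i => l i * |((M ^ m) *ᵥ w) i|)
        (fun i _ => mul_nonneg (hP.left_pos i).le (abs_nonneg _)) (Finset.mem_univ i)
    have hli := hP.left_pos i
    change _ ≤ _ / _ * _
    rw [← div_eq_mul_inv, div_right_comm]
    exact div_le_div_of_nonneg_right ((le_div_iff₀' hli).2 h2) (by positivity)
  have h3 := hwi.const_add (h i * l j / l ⬝ᵥ h)
  rw [add_zero] at h3
  refine h3.congr fun m => ?_
  rw [hw, mulVec_sub, mulVec_smul, pow_mulVec_eq M hP.right, hlj]
  simp
  field_simp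
  ring

/-- The Perron eigenvector of a continuous family of irreducible matrices, normalized to have
sum `1`, is continuous. -/
theorem tendsto_perron_eigenvector [Nonempty n] {B : ℝ → Matrix n n ℝ} {y₀ : ℝ}
    (hB : ContinuousAt B y₀) (hirr : (B y₀).IsIrreducible) {lam : ℝ → ℝ} {h : ℝ → n → ℝ}
    (hh : ∀ y i, 0 < h y i) (hsum : ∀ y, ∑ i, h y i = 1) (hr : ∀ y, B y *ᵥ h y = lam y • h y) :
    Tendsto h (𝓝 y₀) (𝓝 (h y₀)) := by
  obtain ⟨mu, g, l, hP⟩ := hirr.exists_isPerronPair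
  have hmu : lam y₀ = mu := eigenvalue_eq_of_dotProduct_ne_zero
    (dotProduct_pos_of_pos hP.left_pos (hh y₀)).ne' hP.left (hr y₀)
  have hlam (y : ℝ) : lam y = ∑ i, (B y *ᵥ h y) i := by
    simp [hr, ← Finset.mul_sum, hsum]
  -- Any cluster point is a nonnegative eigenvector of `B y₀` in the simplex, and simplicity leaves
  -- only `h y₀`. The eigenvalues converge along the ultrafilter because the normalization writes
  -- them as sums of entries of `B y *ᵥ h y`.
  refine (isCompact_stdSimplex ℝ n).tendsto_nhds_of_unique_mapClusterPt
    (Eventually.of_forall fun y => ⟨fun i => (hh y i).le, hsum y⟩) fun x hx hcl => ?_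
  rw [mapClusterPt_iff_ultrafilter] at hcl
  obtain ⟨U, hU, hUx⟩ := hcl
  have hBU : Tendsto B U (𝓝 (B y₀)) := hB.mono_left hU
  have h1 : Tendsto (fun y => B y *ᵥ h y) U (𝓝 (B y₀ *ᵥ x)) :=
    ((continuous_fst.matrix_mulVec continuous_snd).tendsto (B y₀, x)).comp (hBU.prodMk_nhds hUx)
  have h2 : Tendsto lam U (𝓝 (∑ i, (B y₀ *ᵥ x) i)) := by
    rw [funext hlam]
    exact tendsto_finsetSum _ fun i _ => (tendsto_pi_nhds.1 h1) i
  have h3 : B y₀ *ᵥ x = (∑ i, (B y₀ *ᵥ x) i) • x :=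
    tendsto_nhds_unique h1 (by simpa only [hr] using h2.smul hUx)
  have hxne : x ≠ 0 := by
    rintro rfl
    simpa using hx.2
  have hlx : l ⬝ᵥ x ≠ 0 := by
    obtain ⟨j, hj⟩ := Function.ne_iff.1 hxne
    exact (Finset.sum_pos' (fun i _ => mul_nonneg (hP.left_pos i).le (hx.1 i))
      ⟨j, Finset.mem_univ j, mul_pos (hP.left_pos j) ((hx.1 j).lt_of_ne' hj)⟩).ne'
  have h4 := eigenvalue_eq_of_dotProduct_ne_zero hlx hP.left h3
  rw [h4] at h3
  have h5 := hP.eigenvector_eq_smul hirr h3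
  have h6 := hP.eigenvector_eq_smul hirr (hmu ▸ hr y₀)
  have hs1 := hx.2
  have hs2 := hsum y₀
  rw [h5] at hs1
  rw [h6] at hs2
  simp only [Pi.smul_apply, smul_eq_mul, ← Finset.mul_sum] at hs1 hs2
  have h7 : ∑ i, g i ≠ 0 := by
    rintro h0
    simp [h0] at hs1
  rw [h5, h6, mul_right_cancel₀ h7 (hs1.trans hs2.symm)]

/-- The Perron eigenvalue of a differentiable family of irreducible matrices is differentiable. -/
theorem hasDerivAt_perron_eigenvalue [Nonempty n] {B : ℝ → Matrix n n ℝ} {B' : Matrix n n ℝ}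
    {y₀ : ℝ} (hB : ∀ i j, HasDerivAt (fun y => B y i j) (B' i j) y₀) {lam : ℝ → ℝ}
    {h l : ℝ → n → ℝ} (hirr : (B y₀).IsIrreducible)
    (hP : ∀ y, (B y).IsPerronPair (lam y) (h y) (l y)) :
    HasDerivAt lam (l y₀ ⬝ᵥ (B' *ᵥ h y₀) / l y₀ ⬝ᵥ h y₀) y₀ := by
  have hBc : ContinuousAt B y₀ :=
    continuousAt_pi.2 fun i => continuousAt_pi.2 fun j => (hB i j).continuousAt
  have hs (y : ℝ) : 0 < ∑ i, h y i :=
    Finset.sum_pos (fun i _ => (hP y).right_pos i) Finset.univ_nonempty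
  set g : ℝ → n → ℝ := fun y => (∑ i, h y i)⁻¹ • h y with hg
  have hgpos (y : ℝ) (i : n) : 0 < g y i := mul_pos (inv_pos.2 (hs y)) ((hP y).right_pos i)
  have hgr (y : ℝ) : B y *ᵥ g y = lam y • g y := by
    rw [hg]
    simp only
    rw [mulVec_smul, (hP y).right, smul_comm]
  have hgt : Tendsto g (𝓝 y₀) (𝓝 (g y₀)) :=
    tendsto_perron_eigenvector hBc hirr hgpos
      (fun y => by simp [g, ← Finset.mul_sum, (hs y).ne']) hgr
  have hlg (y : ℝ) : 0 < l y₀ ⬝ᵥ g y := dotProduct_pos_of_pos (hP y₀).left_pos (hgpos y)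
  -- Pairing with the left eigenvector frozen at `y₀` removes the increment of the eigenvector, so
  -- continuity of `g` is enough and no derivative of it is needed.
  have hdiff (y : ℝ) : slope lam y₀ y =
      (∑ i, ∑ j, l y₀ i * (slope (fun y => B y i j) y₀ y * g y j)) / l y₀ ⬝ᵥ g y := by
    rw [eq_div_iff (hlg y).ne']
    have h1 : (lam y - lam y₀) * l y₀ ⬝ᵥ g y =
        ∑ i, ∑ j, l y₀ i * ((B y i j - B y₀ i j) * g y j) := by
      have h2 : l y₀ ⬝ᵥ (B y *ᵥ g y) = lam y * l y₀ ⬝ᵥ g y := by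
        rw [hgr, dotProduct_smul, smul_eq_mul]
      have h3 : l y₀ ⬝ᵥ (B y₀ *ᵥ g y) = lam y₀ * l y₀ ⬝ᵥ g y := by
        rw [dotProduct_mulVec, (hP y₀).left, smul_dotProduct, smul_eq_mul]
      rw [sub_mul, ← h2, ← h3, ← dotProduct_sub, ← sub_mulVec]
      simp only [mulVec, dotProduct, Finset.mul_sum, sub_apply]
    simp only [slope_def_field]
    rw [div_mul_eq_mul_div, h1, Finset.sum_div]
    refine Finset.sum_congr rfl fun i _ => ?_
    rw [Finset.sum_div]
    exact Finset.sum_congr rfl fun j _ => by ring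
  have heq : l y₀ ⬝ᵥ (B' *ᵥ h y₀) / l y₀ ⬝ᵥ h y₀ =
      (∑ i, ∑ j, l y₀ i * (B' i j * g y₀ j)) / l y₀ ⬝ᵥ g y₀ := by
    have h1 : ∑ i, ∑ j, l y₀ i * (B' i j * g y₀ j) = l y₀ ⬝ᵥ (B' *ᵥ g y₀) := by
      simp only [mulVec, dotProduct, Finset.mul_sum]
    rw [h1, hg]
    simp only
    rw [mulVec_smul, dotProduct_smul, dotProduct_smul, smul_eq_mul, smul_eq_mul,
      mul_div_mul_left _ _ (inv_pos.2 (hs y₀)).ne']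
  rw [hasDerivAt_iff_tendsto_slope, heq, funext hdiff]
  have hgt' : Tendsto g (𝓝[≠] y₀) (𝓝 (g y₀)) := hgt.mono_left nhdsWithin_le_nhds
  refine Tendsto.div ?_ ?_ (hlg y₀).ne'
  · refine tendsto_finsetSum _ fun i _ => tendsto_finsetSum _ fun j _ => ?_
    exact (((hB i j).tendsto_slope).mul ((tendsto_pi_nhds.1 hgt') j)).const_mul _
  · exact tendsto_finsetSum _ fun i _ => ((tendsto_pi_nhds.1 hgt') i).const_mul _

end Matrix

/-! ### A Gärtner–Ellis theorem for integer-valued masses on `ℤ` -/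

namespace MassGrowth

theorem log_natCast_div_le {k t : ℕ} (ht : 0 < t) {a : ℝ} (h : (k : ℝ) ≤ Real.exp (t * a)) :
    ENNReal.log (k : ℝ≥0∞) / (t : EReal) ≤ (a : EReal) := by
  have ht' : (0 : EReal) < (t : EReal) := by exact_mod_cast ht
  rw [EReal.div_le_iff_le_mul ht' (EReal.natCast_ne_top t)]
  have h1 : (k : ℝ≥0∞) ≤ ENNReal.ofReal (Real.exp (t * a)) := by
    rw [← ENNReal.ofReal_natCast]
    exact ENNReal.ofReal_le_ofReal h
  refine (ENNReal.log_le_log h1).trans (le_of_eq ?_)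
  rw [ENNReal.log_ofReal_of_pos (Real.exp_pos _), Real.log_exp]
  push_cast
  rfl

theorem le_log_natCast_div {k t : ℕ} (ht : 0 < t) {a : ℝ} (h : Real.exp (t * a) ≤ (k : ℝ)) :
    (a : EReal) ≤ ENNReal.log (k : ℝ≥0∞) / (t : EReal) := by
  have ht' : (0 : EReal) < (t : EReal) := by exact_mod_cast ht
  rw [EReal.le_div_iff_mul_le ht' (EReal.natCast_ne_top t)]
  have h1 : ENNReal.ofReal (Real.exp (t * a)) ≤ (k : ℝ≥0∞) := by
    rw [← ENNReal.ofReal_natCast]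
    exact ENNReal.ofReal_le_ofReal h
  refine (le_of_eq ?_).trans (ENNReal.log_le_log h1)
  rw [ENNReal.log_ofReal_of_pos (Real.exp_pos _), Real.log_exp, mul_comm]
  push_cast
  rfl

/-- The exponential growth rate at time `t` of the mass in the window `|x / t - α| < ε`. -/
noncomputable def windowGrowth (m : ℕ → ℤ → ℕ) (α ε : ℝ) (t : ℕ) : EReal :=
  ENNReal.log (∑' x : {x : ℤ // |(x : ℝ) / t - α| < ε}, (m t x : ℝ≥0∞)) / (t : EReal)

/-- The moment generating function of a mass distribution. -/
noncomputable def mgf (m : ℤ → ℕ) (y : ℝ) : ℝ :=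
  ∑ᶠ x : ℤ, (m x : ℝ) * Real.exp (y * x)

open Classical in
/-- The mass in the window `|x / t - α| < ε`. -/
noncomputable def windowMass (m : ℤ → ℕ) (F : Finset ℤ) (α ε : ℝ) (t : ℕ) : ℕ :=
  ∑ x ∈ F.filter fun x : ℤ => |(x : ℝ) / t - α| < ε, m x

variable {m : ℕ → ℤ → ℕ}

theorem windowGrowth_eq {F : Finset ℤ} {t : ℕ} (hF : (m t).support ⊆ F) (α ε : ℝ) :
    windowGrowth m α ε t = ENNReal.log (windowMass (m t) F α ε t : ℝ≥0∞) / (t : EReal) := by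
  classical
  rw [windowGrowth, windowMass]
  congr 2
  refine (tsum_subtype {x : ℤ | |(x : ℝ) / t - α| < ε} (fun x => (m t x : ℝ≥0∞))).trans ?_
  rw [tsum_eq_sum (s := F), Finset.sum_filter, Nat.cast_sum]
  · refine Finset.sum_congr rfl fun x _ => ?_
    simp only [Set.indicator_apply, Set.mem_ofPred_eq]
    split_ifs <;> simp
  · intro x hx
    have : m t x = 0 := by
      by_contra h
      exact hx (hF h)
    simp [Set.indicator_apply, this]

theorem mgf_eq_sum {m : ℤ → ℕ} {F : Finset ℤ} (hF : m.support ⊆ F) (y : ℝ) :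
    mgf m y = ∑ x ∈ F, (m x : ℝ) * Real.exp (y * x) := by
  refine finsum_eq_sum_of_support_subset _ (subset_trans (fun x hx => ?_) hF)
  intro h
  simp [h] at hx

theorem windowGrowth_mono (m : ℕ → ℤ → ℕ) {α α' ε ε' : ℝ} (h : |α' - α| + ε' ≤ ε) (t : ℕ) :
    windowGrowth m α' ε' t ≤ windowGrowth m α ε t := by
  refine EReal.div_le_div_right_of_nonneg (by positivity) (ENNReal.log_le_log ?_)
  refine ENNReal.tsum_mono_subtype (fun x : ℤ => (m t x : ℝ≥0∞))
    (s := {x : ℤ | |(x : ℝ) / t - α'| < ε'}) (t := {x : ℤ | |(x : ℝ) / t - α| < ε}) fun x hx => ?_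
  simp only [Set.mem_ofPred_eq] at hx ⊢
  have := abs_sub_le ((x : ℝ) / t) α' α
  linarith

theorem abs_sub_lt_of_window {x : ℤ} {t : ℕ} (ht : 0 < t) {α ε : ℝ}
    (h : |(x : ℝ) / t - α| < ε) (y : ℝ) : |y * x - t * (y * α)| ≤ t * (|y| * ε) := by
  have ht' : (0 : ℝ) < t := by exact_mod_cast ht
  have h1 : y * x - t * (y * α) = t * (y * ((x : ℝ) / t - α)) := by field_simp
  rw [h1, abs_mul, abs_mul, abs_of_pos ht']
  gcongr

/-- Chernoff's bound: inside the window `y * x` differs from `t * y * α` by at most `t * |y| * ε`.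
-/
theorem windowMass_le {m : ℤ → ℕ} {F : Finset ℤ} {t : ℕ} (ht : 0 < t) (hF : m.support ⊆ F)
    (α ε y : ℝ) :
    (windowMass m F α ε t : ℝ) ≤ mgf m y * Real.exp (t * (-(y * α) + |y| * ε)) := by
  classical
  rw [mgf_eq_sum hF, Finset.sum_mul, windowMass, Nat.cast_sum]
  refine (Finset.sum_le_sum fun x hx => ?_).trans (Finset.sum_le_sum_of_subset_of_nonneg
    (Finset.filter_subset _ F) fun _ _ _ => by positivity)
  have h1 := abs_le.1 (abs_sub_lt_of_window ht (Finset.mem_filter.1 hx).2 y)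
  rw [mul_assoc, ← Real.exp_add]
  exact le_mul_of_one_le_right (by positivity) (Real.one_le_exp (by linarith [h1.1]))

/-- Mass right of the window is absorbed by the tilt `y + s`, mass left of it by `y - s`: there the
extra exponential factor is at least `1`. -/
theorem mgf_le_windowMass {m : ℤ → ℕ} {F : Finset ℤ} {t : ℕ} (ht : 0 < t) (hF : m.support ⊆ F)
    (α ε y : ℝ) {s : ℝ} (hs : 0 < s) :
    mgf m y ≤ windowMass m F α ε t * Real.exp (t * (y * α + |y| * ε)) +
      mgf m (y + s) * Real.exp (t * (-(s * (α + ε)))) +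
      mgf m (y - s) * Real.exp (t * (s * (α - ε))) := by
  classical
  have ht' : (0 : ℝ) < t := by exact_mod_cast ht
  rw [mgf_eq_sum hF, mgf_eq_sum hF, mgf_eq_sum hF, windowMass, Nat.cast_sum, Finset.sum_mul,
    Finset.sum_mul, Finset.sum_mul, Finset.sum_filter, ← Finset.sum_add_distrib,
    ← Finset.sum_add_distrib]
  refine Finset.sum_le_sum fun x _ => ?_
  have h1 : (0 : ℝ) ≤ m x * Real.exp ((y + s) * x) * Real.exp (t * (-(s * (α + ε)))) := by
    positivity
  have h2 : (0 : ℝ) ≤ m x * Real.exp ((y - s) * x) * Real.exp (t * (s * (α - ε))) := by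
    positivity
  split_ifs with hx
  · have h3 := abs_le.1 (abs_sub_lt_of_window ht hx y)
    have h4 : (m x : ℝ) * Real.exp (y * x) ≤ m x * Real.exp (t * (y * α + |y| * ε)) :=
      mul_le_mul_of_nonneg_left (Real.exp_le_exp.2 (by linarith [h3.2])) (by positivity)
    linarith
  · rw [zero_add]
    rcases le_abs.1 (not_lt.1 hx) with h3 | h3
    · have h4 : t * (α + ε) ≤ x := by
        have : α + ε ≤ (x : ℝ) / t := by linarith
        rwa [le_div_iff₀' ht'] at this
      refine le_add_of_le_of_nonneg ?_ h2
      rw [mul_assoc, ← Real.exp_add]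
      exact mul_le_mul_of_nonneg_left (Real.exp_le_exp.2 (by nlinarith)) (by positivity)
    · have h4 : x ≤ t * (α - ε) := by
        have : (x : ℝ) / t ≤ α - ε := by linarith
        rwa [div_le_iff₀' ht'] at this
      refine le_add_of_nonneg_of_le h1 ?_
      rw [mul_assoc, ← Real.exp_add]
      exact mul_le_mul_of_nonneg_left (Real.exp_le_exp.2 (by nlinarith)) (by positivity)

/-- The masses `m t` have finite support and the logarithmic moment generating function `G`. -/
structure HasLogMgf (m : ℕ → ℤ → ℕ) (G : ℝ → ℝ) : Prop where
  finite (t : ℕ) : (m t).support.Finite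
  pos (y : ℝ) (t : ℕ) : 0 < mgf (m t) y
  tendsto (y : ℝ) : Tendsto (fun t : ℕ => Real.log (mgf (m t) y) / t) atTop (𝓝 (G y))

variable {G : ℝ → ℝ}

theorem HasLogMgf.eventually_le (hm : HasLogMgf m G) (y : ℝ) {b : ℝ} (hb : G y < b) :
    ∀ᶠ t : ℕ in atTop, mgf (m t) y ≤ Real.exp (t * b) := by
  filter_upwards [(hm.tendsto y).eventually_lt_const hb, eventually_gt_atTop 0] with t h ht
  rw [div_lt_iff₀' (by exact_mod_cast ht)] at h
  exact (Real.log_le_iff_le_exp (hm.pos y t)).1 h.le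

theorem HasLogMgf.eventually_ge (hm : HasLogMgf m G) (y : ℝ) {b : ℝ} (hb : b < G y) :
    ∀ᶠ t : ℕ in atTop, Real.exp (t * b) ≤ mgf (m t) y := by
  filter_upwards [(hm.tendsto y).eventually_const_lt hb, eventually_gt_atTop 0] with t h ht
  rw [lt_div_iff₀' (by exact_mod_cast ht)] at h
  exact (Real.le_log_iff_exp_le (hm.pos y t)).1 h.le

theorem HasLogMgf.limsup_windowGrowth_le (hm : HasLogMgf m G) (α ε y : ℝ) :
    limsup (windowGrowth m α ε) atTop ≤ ((G y - y * α + |y| * ε : ℝ) : EReal) := by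
  have h1 : Tendsto (fun t : ℕ => ((Real.log (mgf (m t) y) / t - y * α + |y| * ε : ℝ) : EReal))
      atTop (𝓝 ((G y - y * α + |y| * ε : ℝ) : EReal)) :=
    (continuous_coe_real_ereal.tendsto _).comp (((hm.tendsto y).sub_const _).add_const _)
  rw [← h1.limsup_eq]
  refine limsup_le_limsup ?_
  filter_upwards [eventually_gt_atTop 0] with t ht
  have hF : (m t).support ⊆ ((hm.finite t).toFinset : Set ℤ) := by simp
  have ht' : (0 : ℝ) < t := by exact_mod_cast ht
  rw [windowGrowth_eq hF]
  refine log_natCast_div_le ht ((windowMass_le ht hF α ε y).trans (le_of_eq ?_))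
  rw [← Real.exp_log (hm.pos y t), ← Real.exp_add, Real.log_exp]
  congr 1
  field_simp
  ring

theorem eventually_mul_le (a : ℝ) {d : ℝ} (hd : 0 < d) : ∀ᶠ t : ℕ in atTop, a ≤ t * d :=
  (tendsto_natCast_atTop_atTop.atTop_mul_const hd).eventually_ge_atTop a

theorem exists_pos_near_tangent {g y ε : ℝ} (hG : HasDerivAt G g y) (hε : 0 < ε) :
    ∃ s, 0 < s ∧ G (y + s) ≤ G y + s * g + s * ε ∧ G (y - s) ≤ G y - s * g + s * ε := by
  have h1 := (hasDerivAt_iff_isLittleO.1 hG).def hε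
  have h2 : Tendsto (fun s : ℝ => y + s) (𝓝[>] 0) (𝓝 y) :=
    ((continuous_const.add continuous_id).tendsto' 0 y (by simp)).mono_left nhdsWithin_le_nhds
  have h3 : Tendsto (fun s : ℝ => y - s) (𝓝[>] 0) (𝓝 y) :=
    ((continuous_const.sub continuous_id).tendsto' 0 y (by simp)).mono_left nhdsWithin_le_nhds
  obtain ⟨s, ha, hb, hs⟩ :=
    ((h2.eventually h1).and ((h3.eventually h1).and self_mem_nhdsWithin)).exists
  have hs : 0 < s := hs
  refine ⟨s, hs, ?_, ?_⟩
  · have := le_of_abs_le ha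
    simp only [add_sub_cancel_left, smul_eq_mul, Real.norm_eq_abs, abs_of_pos hs] at this
    linarith
  · have := le_of_abs_le hb
    simp only [sub_sub_cancel_left, smul_eq_mul, Real.norm_eq_abs, abs_neg, abs_of_pos hs] at this
    linarith

/-- Under the tilt `y` the mass concentrates near the slope `g`: for small `s` the error of the
tangent line is below the gain `s * ε` in each tail, so the tails carry at most half of `mgf (m t)
y`. -/
theorem HasLogMgf.eventually_le_windowGrowth (hm : HasLogMgf m G) {g y : ℝ}
    (hG : HasDerivAt G g y) {ε d : ℝ} (hε : 0 < ε) (hd : 0 < d) :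
    ∀ᶠ t : ℕ in atTop, ((G y - y * g - |y| * ε - d : ℝ) : EReal) ≤ windowGrowth m g ε t := by
  obtain ⟨s, hs, hs1, hs2⟩ := exists_pos_near_tangent hG (half_pos hε)
  -- `r` is the error allowed in the three logarithmic limits. The tails keep a margin `s * ε / 4`,
  -- which beats the factor `4`; of `d`, one half pays for `r` and the other for the factor `2`.
  set r := min (s * ε / 16) (d / 2) with hr
  have hsε : 0 < s * ε := mul_pos hs hε
  have hr0 : 0 < r := lt_min (by positivity) (by positivity)
  have hr1 : r ≤ s * ε / 16 := min_le_left _ _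
  have hr2 : r ≤ d / 2 := min_le_right _ _
  filter_upwards [hm.eventually_ge y (sub_lt_self (G y) hr0),
    hm.eventually_le (y + s) (lt_add_of_pos_right _ hr0),
    hm.eventually_le (y - s) (lt_add_of_pos_right _ hr0), eventually_gt_atTop 0,
    eventually_mul_le (Real.log 4) (show 0 < s * ε / 4 by positivity),
    eventually_mul_le (Real.log 2) (half_pos hd)] with t h1 h2 h3 ht h4 h5
  have hF : (m t).support ⊆ ((hm.finite t).toFinset : Set ℤ) := by simp
  have ht' : (0 : ℝ) < t := by exact_mod_cast ht
  rw [windowGrowth_eq hF]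
  refine le_log_natCast_div ht ?_
  have h6 := mgf_le_windowMass ht hF g ε y hs
  set k : ℝ := ((windowMass (m t) (hm.finite t).toFinset g ε t : ℕ) : ℝ)
  set X := Real.exp (t * (G y - r)) with hX
  have hexp4 : Real.exp (-Real.log 4) = 1 / 4 := by
    rw [Real.exp_neg, Real.exp_log (by norm_num)]; norm_num
  have hexp2 : Real.exp (-Real.log 2) = 1 / 2 := by
    rw [Real.exp_neg, Real.exp_log (by norm_num)]; norm_num
  have h7 : mgf (m t) (y + s) * Real.exp (t * (-(s * (g + ε)))) ≤ X * (1 / 4) := by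
    refine (mul_le_mul_of_nonneg_right h2 (Real.exp_pos _).le).trans ?_
    rw [← Real.exp_add, ← hexp4, hX, ← Real.exp_add]
    refine Real.exp_le_exp.2 ?_
    have : (t : ℝ) * (G (y + s) + r + -(s * (g + ε))) ≤ t * (G y - r - s * ε / 4) :=
      mul_le_mul_of_nonneg_left (by linarith) ht'.le
    linarith
  have h8 : mgf (m t) (y - s) * Real.exp (t * (s * (g - ε))) ≤ X * (1 / 4) := by
    refine (mul_le_mul_of_nonneg_right h3 (Real.exp_pos _).le).trans ?_
    rw [← Real.exp_add, ← hexp4, hX, ← Real.exp_add]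
    refine Real.exp_le_exp.2 ?_
    have : (t : ℝ) * (G (y - s) + r + s * (g - ε)) ≤ t * (G y - r - s * ε / 4) :=
      mul_le_mul_of_nonneg_left (by linarith) ht'.le
    linarith
  have h9 : X * (1 / 2) ≤ k * Real.exp (t * (y * g + |y| * ε)) := by linarith
  have h10 : Real.exp (t * (G y - y * g - |y| * ε - d)) * Real.exp (t * (y * g + |y| * ε))
      ≤ X * (1 / 2) := by
    rw [← hexp2, hX, ← Real.exp_add, ← Real.exp_add]
    refine Real.exp_le_exp.2 ?_
    have : (t : ℝ) * r ≤ t * (d / 2) := mul_le_mul_of_nonneg_left hr2 ht'.le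
    linarith
  exact le_of_mul_le_mul_right (h10.trans h9) (Real.exp_pos _)

theorem HasLogMgf.le_liminf_windowGrowth (hm : HasLogMgf m G) {g y : ℝ} (hG : HasDerivAt G g y)
    {ε : ℝ} (hε : 0 < ε) :
    ((G y - y * g : ℝ) : EReal) ≤ liminf (windowGrowth m g ε) atTop := by
  refine EReal.ge_of_forall_gt_iff_ge.1 fun b hb => ?_
  have hb : b < G y - y * g := by exact_mod_cast hb
  set d := G y - y * g - b with hd
  have hd0 : 0 < d := sub_pos.2 hb
  set e := min ε (d / (2 * (|y| + 1))) with he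
  have he0 : 0 < e := lt_min hε (by positivity)
  have he1 : |y| * e ≤ d / 2 := by
    have h1 : e * (2 * (|y| + 1)) ≤ d := (le_div_iff₀ (by positivity)).1 (min_le_right _ _)
    nlinarith [abs_nonneg y]
  refine le_liminf_of_le (by isBoundedDefault) ?_
  filter_upwards [hm.eventually_le_windowGrowth hG he0 (half_pos hd0)] with t ht
  refine le_trans ?_ (ht.trans (windowGrowth_mono m (by simp [he]) t))
  exact_mod_cast (by linarith : b ≤ G y - y * g - |y| * e - d / 2)

/-- The lower large deviation bound for a differentiable logarithmic moment generating function. -/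
theorem HasLogMgf.iInf_le_liminf_windowGrowth (hm : HasLogMgf m G) {G' : ℝ → ℝ}
    (hG : ∀ y, HasDerivAt G (G' y) y) (α : ℝ) {ε : ℝ} (hε : 0 < ε) :
    ⨅ y : ℝ, ((G y - y * α : ℝ) : EReal) ≤ liminf (windowGrowth m α ε) atTop := by
  refine EReal.ge_of_forall_gt_iff_ge.1 fun b hb => ?_
  have hb (y : ℝ) : b ≤ G y - y * α := by
    exact_mod_cast hb.le.trans (iInf_le (fun y : ℝ => ((G y - y * α : ℝ) : EReal)) y)
  set c := G 0 - b + 1 with hc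
  have hc0 : 0 < c := by
    have := hb 0
    rw [zero_mul, sub_zero] at this
    linarith
  set d := ε ^ 2 / (16 * c) with hd
  have hd0 : 0 < d := by positivity
  -- The infimum of `G y - y * α` need not be attained. The quadratic penalty forces a minimizer
  -- `z`, with slope `G' z = α - d * z`; the choice of `d` gives `(d * z) ^ 2 ≤ 2 * d * c = ε ^ 2 /
  -- 8`, so the window of radius `ε / 2` at `G' z` lies in the given one.
  let f : ℝ → ℝ := fun y => G y - y * α + d / 2 * y ^ 2
  have hfd (y : ℝ) : HasDerivAt f (G' y - α + d * y) y := by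
    have h1 := ((hG y).sub ((hasDerivAt_id y).mul_const α)).add
      (((hasDerivAt_id y).pow 2).const_mul (d / 2))
    refine h1.congr_deriv ?_
    simp
    ring
  have hft : Tendsto f (cocompact ℝ) atTop := by
    have h1 : Tendsto (fun y : ℝ => b + d / 2 * ‖y‖ ^ 2) (cocompact ℝ) atTop :=
      tendsto_atTop_add_const_left _ _ (((tendsto_pow_atTop two_ne_zero).comp
        (tendsto_norm_cocompact_atTop (E := ℝ))).const_mul_atTop (by positivity))
    refine tendsto_atTop_mono (fun y => ?_) h1
    rw [Real.norm_eq_abs, sq_abs]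
    have := hb y
    simp only [f]
    linarith
  obtain ⟨z, hz⟩ :=
    (continuous_iff_continuousAt.2 fun y => (hfd y).continuousAt).exists_forall_le hft
  have hz0 : G' z - α + d * z = 0 :=
    IsLocalMin.hasDerivAt_eq_zero (Eventually.of_forall hz) (hfd z)
  have hz1 : d / 2 * z ^ 2 ≤ c := by
    have h1 : f z ≤ f 0 := hz 0
    simp only [f] at h1
    have h2 := hb z
    norm_num at h1
    linarith
  have hz2 : |G' z - α| ≤ ε / 2 := by
    have h1 : G' z - α = -(d * z) := by linarith
    rw [h1, abs_neg]
    refine abs_le_of_sq_le_sq ?_ (by positivity)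
    have h2 : d * (16 * c) = ε ^ 2 := div_mul_cancel₀ _ (by positivity)
    have h3 : d * (d / 2 * z ^ 2) ≤ d * c := mul_le_mul_of_nonneg_left hz1 hd0.le
    nlinarith
  have h1 := hm.le_liminf_windowGrowth (hG z) (half_pos hε)
  -- Replacing `α` by `G' z` only helps: it adds `d * z ^ 2`.
  have h2 : b ≤ G z - z * G' z := by
    have h3 : G' z = α - d * z := by linarith
    have h4 : 0 ≤ d * z ^ 2 := by positivity
    rw [h3]
    nlinarith [hb z]
  calc (b : EReal) ≤ ((G z - z * G' z : ℝ) : EReal) := by exact_mod_cast h2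
    _ ≤ _ := h1
    _ ≤ _ := liminf_le_liminf (Eventually.of_forall fun t =>
      windowGrowth_mono m (by linarith) t)

end MassGrowth

namespace BinaryCA

variable (A : BinaryCA)

/-! ### Covariance and linearity of the defect dynamics -/

theorem step_shift (η : ℤ → Bool) (s : ℤ) :
    A.step (fun x => η (x - s)) = fun x => A.step η (x - s) := by
  funext x
  simp only [step]
  congr 1
  funext v
  congr 1
  ring

theorem iterate_step_shift (η : ℤ → Bool) (s : ℤ) (t : ℕ) :
    A.step^[t] (fun x => η (x - s)) = fun x => A.step^[t] η (x - s) := by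
  induction t with
  | zero => rfl
  | succ t ih => rw [Function.iterate_succ_apply', ih, step_shift, Function.iterate_succ_apply']

theorem perturb_shift (η : ℤ → Bool) (s y : ℤ) :
    perturb (fun x => η (x - s)) y = fun x => perturb η (y - s) (x - s) := by
  funext x
  simp only [perturb, Function.update_apply, sub_left_inj]

theorem change_shift (η : ℤ → Bool) (s y x : ℤ) :
    A.change (fun x => η (x - s)) y x = A.change η (y - s) (x - s) := by
  simp only [change, perturb_shift, step_shift]

theorem defects_shift (η : ℤ → Bool) (Δ : ℤ → ℕ) (s : ℤ) (t : ℕ) (x : ℤ) :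
    A.defects (fun x => η (x - s)) (fun x => Δ (x - s)) t x = A.defects η Δ t (x - s) := by
  induction t generalizing x with
  | zero => rfl
  | succ t ih =>
    simp only [defects, iterate_step_shift, change_shift, ih, add_sub_right_comm]

theorem defects_add (η : ℤ → Bool) (Δ : ℤ → ℕ) (s t : ℕ) :
    A.defects η Δ (s + t) = A.defects (A.step^[s] η) (A.defects η Δ s) t := by
  induction t with
  | zero => rfl
  | succ t ih =>
    funext x
    rw [← add_assoc]
    simp only [defects, ih, ← Function.iterate_add_apply, add_comm t s]

theorem defects_eq_sum (η : ℤ → Bool) {Δ : ℤ → ℕ} {F : Finset ℤ} (hF : Δ.support ⊆ F) (t : ℕ)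
    (x : ℤ) : A.defects η Δ t x = ∑ a ∈ F, Δ a * A.defectsFrom η a t x := by
  induction t generalizing x with
  | zero =>
    simp only [defects, defectsFrom, Pi.single_apply, mul_ite, mul_one, mul_zero,
      Finset.sum_ite_eq]
    split_ifs with h
    · rfl
    · by_contra h'
      exact h (hF h')
  | succ t ih =>
    simp only [defectsFrom] at ih ⊢
    simp only [defects, ih, Finset.mul_sum]
    rw [Finset.sum_comm]
    refine Finset.sum_congr rfl fun a _ => Finset.sum_congr rfl fun v _ => ?_
    ring

theorem defects_zero (η : ℤ → Bool) (t : ℕ) : A.defects η 0 t = 0 := by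
  funext x
  rw [A.defects_eq_sum η (F := ∅) (by simp)]
  rfl

theorem defectsFrom_support_finite (η : ℤ → Bool) (a : ℤ) (t : ℕ) :
    (A.defectsFrom η a t).support.Finite :=
  A.defects_support_finite η _ ((Set.finite_singleton a).subset Pi.support_single_subset) t

theorem defectsFrom_shift (η : ℤ → Bool) (s a : ℤ) (t : ℕ) (x : ℤ) :
    A.defectsFrom (fun x => η (x - s)) a t x = A.defectsFrom η (a - s) t (x - s) := by
  have h : (Pi.single a 1 : ℤ → ℕ) = fun x => (Pi.single (a - s) 1 : ℤ → ℕ) (x - s) := by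
    funext x
    simp [Pi.single_apply]
  rw [defectsFrom, h, defects_shift]
  rfl

theorem defectsFrom_add (η : ℤ → Bool) (a : ℤ) (s t : ℕ) (x : ℤ) :
    A.defectsFrom η a (s + t) x = ∑ z ∈ (A.defectsFrom_support_finite η a s).toFinset,
      A.defectsFrom η a s z * A.defectsFrom (A.step^[s] η) z t x := by
  rw [defectsFrom, defects_add]
  exact A.defects_eq_sum _ (by simp [defectsFrom]) t x

variable {A}

/-! ### Weighted defect sums -/

/-- The sum of the defects started from a single defect at `a`, with the defects at `x` weighted by
`g x` and by the exponential of `y` times their displacement. -/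
noncomputable def weightedSum (A : BinaryCA) (η : ℤ → Bool) (y : ℝ) (g : ℤ → ℝ) (t : ℕ) (a : ℤ) :
    ℝ :=
  ∑ᶠ x : ℤ, g x * Real.exp (y * (x - a)) * A.defectsFrom η a t x

variable {η : ℤ → Bool}

theorem weightedSum_support_finite (y : ℝ) (g : ℤ → ℝ) (t : ℕ) (a : ℤ) :
    (Function.support fun x : ℤ =>
      g x * Real.exp (y * (x - a)) * (A.defectsFrom η a t x : ℝ)).Finite :=
  (A.defectsFrom_support_finite η a t).subset fun x hx h => hx (by simp [h])

theorem weightedSum_time_zero (y : ℝ) (g : ℤ → ℝ) (a : ℤ) : A.weightedSum η y g 0 a = g a := by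
  rw [weightedSum, finsum_eq_single _ a]
  · simp [defectsFrom, defects]
  · intro x hx
    simp [defectsFrom, defects, hx]

/-- The exponential weight depends only on the displacement `x - a`, so a shift of the state moves
only the test function and the starting site. -/
theorem weightedSum_of_shift {q : ℕ} {s : ℤ} (hs : ∀ x, A.step^[q] η x = η (x - s)) (y : ℝ)
    (g : ℤ → ℝ) (t : ℕ) (a : ℤ) :
    A.weightedSum (A.step^[q] η) y g t a = A.weightedSum η y (fun x => g (x + s)) t (a - s) := by
  rw [weightedSum, weightedSum, ← finsum_comp_equiv (Equiv.addRight s)]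
  refine finsum_congr fun x => ?_
  rw [funext hs, defectsFrom_shift]
  simp only [Equiv.coe_addRight, add_sub_cancel_right]
  congr 4
  push_cast
  ring

/-- Markov property: displacements add along a path, so their exponentials multiply. -/
theorem weightedSum_add (y : ℝ) (g : ℤ → ℝ) (s t : ℕ) (a : ℤ) :
    A.weightedSum η y g (s + t) a = ∑ z ∈ (A.defectsFrom_support_finite η a s).toFinset,
      A.defectsFrom η a s z * Real.exp (y * (z - a)) * A.weightedSum (A.step^[s] η) y g t z := by
  have h1 (x : ℤ) : g x * Real.exp (y * (x - a)) * (A.defectsFrom η a (s + t) x : ℝ) =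
      ∑ z ∈ (A.defectsFrom_support_finite η a s).toFinset,
        A.defectsFrom η a s z * Real.exp (y * (z - a)) *
          (g x * Real.exp (y * (x - z)) * A.defectsFrom (A.step^[s] η) z t x) := by
    rw [defectsFrom_add]
    push_cast
    rw [Finset.mul_sum]
    refine Finset.sum_congr rfl fun z _ => ?_
    rw [show y * ((x : ℝ) - a) = y * (z - a) + y * (x - z) by ring, Real.exp_add]
    ring
  rw [weightedSum, finsum_congr h1, finsum_sum_comm]
  · exact Finset.sum_congr rfl fun z _ => (mul_finsum _ _).symm
  · exact fun z _ => (weightedSum_support_finite (A := A) (η := A.step^[s] η) y g t z).subset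
      fun x hx h => hx (by simp only at h ⊢; rw [h, mul_zero])

theorem weightedSum_pos {y : ℝ} {g : ℤ → ℝ} (hg : ∀ x, 0 ≤ g x) {t : ℕ} {a : ℤ} :
    0 < A.weightedSum η y g t a ↔ ∃ x, 0 < g x ∧ 0 < A.defectsFrom η a t x := by
  have h0 (x : ℤ) : 0 ≤ g x * Real.exp (y * (x - a)) * (A.defectsFrom η a t x : ℝ) :=
    mul_nonneg (mul_nonneg (hg x) (Real.exp_pos _).le) (Nat.cast_nonneg _)
  constructor
  · intro h
    by_contra! hx
    refine h.ne' (finsum_eq_zero_of_forall_eq_zero fun x => ?_)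
    rcases (hg x).eq_or_lt with h1 | h1
    · simp [← h1]
    · simp [Nat.le_zero.1 (hx x h1)]
  · rintro ⟨x, hx, hd⟩
    exact finsum_pos h0 ⟨x, mul_pos (mul_pos hx (Real.exp_pos _)) (by exact_mod_cast hd)⟩
      (weightedSum_support_finite y g t a)

/-! ### Residues -/

/-- The residue of an integer modulo `σ`, as a vertex of the expansion graph. -/
def residue (σ : ℕ) [NeZero σ] (x : ℤ) : Fin σ :=
  ⟨(x % σ).toNat, by
    have h : (0 : ℤ) < σ := by exact_mod_cast NeZero.pos σ
    have := Int.emod_nonneg x h.ne'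
    have := Int.emod_lt_of_pos x h
    omega⟩

variable {σ p₀ σ₀ : ℕ}

theorem residue_modEq [NeZero σ] (x : ℤ) : ((residue σ x : ℕ) : ℤ) ≡ x [ZMOD σ] := by
  have h : (0 : ℤ) < σ := by exact_mod_cast NeZero.pos σ
  rw [residue, Int.toNat_of_nonneg (Int.emod_nonneg x h.ne')]
  exact Int.mod_modEq x σ

theorem eq_of_natCast_modEq {i j : Fin σ} (h : ((i : ℕ) : ℤ) ≡ (j : ℕ) [ZMOD σ]) : i = j := by
  rw [Int.natCast_modEq_iff] at h
  exact Fin.ext (Nat.ModEq.eq_of_lt_of_lt h i.2 j.2)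

theorem residue_eq_iff [NeZero σ] {x : ℤ} {j : Fin σ} : residue σ x = j ↔ x ≡ (j : ℕ) [ZMOD σ] := by
  constructor
  · rintro rfl
    exact (residue_modEq x).symm
  · exact fun h => eq_of_natCast_modEq ((residue_modEq x).trans h)

theorem periodic_modEq {β : Type*} {g : ℤ → β} (hg : Function.Periodic g (σ : ℤ)) {x y : ℤ}
    (h : x ≡ y [ZMOD σ]) : g x = g y := by
  obtain ⟨k, hk⟩ := h.dvd
  rw [show y = x + k * σ by linarith]
  exact (hg.int_mul k x).symm

theorem IsSpatialPeriod.periodic {η : ℤ → Bool} {s : ℕ} (h : ∀ x : ℤ, η x = η (x % s)) :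
    Function.Periodic η (s : ℤ) := fun x => by
  rw [h, h x, Int.add_emod_right]

theorem weightedSum_periodic (hη : Function.Periodic η (σ : ℤ)) (y : ℝ) {g : ℤ → ℝ}
    (hg : Function.Periodic g (σ : ℤ)) (t : ℕ) :
    Function.Periodic (A.weightedSum η y g t) (σ : ℤ) := fun a => by
  have h := weightedSum_of_shift (A := A) (q := 0) (s := (σ : ℤ)) (fun x => (hη.sub_eq x).symm)
    y g t (a + σ)
  rw [add_sub_cancel_right, funext hg] at h
  exact h

/-! ### The tilted vertex matrix -/

/-- The vertex at which an edge ends. -/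
def Edge.target [NeZero σ] (e : A.Edge η σ p₀) (σ₀ : ℕ) : Fin σ :=
  residue σ ((e.source : ℕ) + e.D - σ₀)

theorem Edge.endsAt_iff [NeZero σ] (e : A.Edge η σ p₀) (j : Fin σ) :
    e.EndsAt σ₀ j ↔ e.target σ₀ = j :=
  residue_eq_iff.symm

theorem Edge.N_pos (e : A.Edge η σ p₀) : 0 < e.N := Nat.pos_of_ne_zero e.ne_zero

/-- A sum over the edges that emanate from a vertex as a sum over the sites that they lead to. -/
theorem sum_edges_source (i : Fin σ) (f : ℤ → ℝ) :
    ∑ e : A.Edge η σ p₀, (if e.source = i then f ((e.source : ℕ) + e.D) else 0) =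
      ∑ z ∈ (A.defectsFrom_support_finite η (i : ℕ) p₀).toFinset, f z := by
  rw [← Finset.sum_filter]
  refine Finset.sum_bij' (i := fun e _ => (e.source : ℕ) + e.D)
    (j := fun z hz => ⟨i, z - (i : ℕ), by simpa using hz⟩) ?_ ?_ ?_ ?_ ?_
  · rintro e he
    obtain rfl := (Finset.mem_filter.1 he).2
    simpa using e.ne_zero
  · simp
  · rintro e he
    obtain rfl := (Finset.mem_filter.1 he).2
    ext <;> simp
  · simp
  · simp

variable (A η σ p₀ σ₀) in
open Classical in
/-- The matrix whose entry at `(i, j)` is the sum of `N e * exp (y * D e)` over the edges `e` from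
`i` to `j`. -/
noncomputable def tiltedMatrix (y : ℝ) : Matrix (Fin σ) (Fin σ) ℝ :=
  Matrix.of fun i j => ∑ e : A.Edge η σ p₀,
    if e.source = i ∧ e.EndsAt σ₀ j then (e.N : ℝ) * Real.exp (y * e.D) else 0

theorem tiltedMatrix_zero : A.tiltedMatrix η σ p₀ σ₀ 0 = A.vertexMatrix η σ p₀ σ₀ := by
  simp [tiltedMatrix, vertexMatrix]

theorem tiltedMatrix_nonneg (y : ℝ) (i j : Fin σ) : 0 ≤ A.tiltedMatrix η σ p₀ σ₀ y i j :=
  Finset.sum_nonneg fun e _ => by split_ifs <;> positivity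

open Classical in
theorem sum_edges_mulVec [NeZero σ] (f : A.Edge η σ p₀ → ℝ) (v : Fin σ → ℝ) (i : Fin σ) :
    ((Matrix.of fun i j => ∑ e : A.Edge η σ p₀,
      if e.source = i ∧ e.EndsAt σ₀ j then f e else 0 : Matrix (Fin σ) (Fin σ) ℝ).mulVec v) i =
      ∑ e : A.Edge η σ p₀, if e.source = i then f e * v (e.target σ₀) else 0 := by
  simp only [Matrix.mulVec, dotProduct, Matrix.of_apply, Finset.sum_mul, Edge.endsAt_iff]
  rw [Finset.sum_comm]
  refine Finset.sum_congr rfl fun e _ => ?_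
  rw [Finset.sum_eq_single (e.target σ₀)]
  · split_ifs <;> simp_all
  · intro j _ hj
    rw [if_neg (fun h => hj h.2.symm), zero_mul]
  · simp

theorem tiltedMatrix_mulVec [NeZero σ] (y : ℝ) (v : Fin σ → ℝ) (i : Fin σ) :
    (A.tiltedMatrix η σ p₀ σ₀ y).mulVec v i = ∑ e : A.Edge η σ p₀,
      if e.source = i then (e.N : ℝ) * Real.exp (y * e.D) * v (e.target σ₀) else 0 :=
  sum_edges_mulVec _ v i

theorem tiltedMatrix_vecMul [NeZero σ] (y : ℝ) (v : Fin σ → ℝ) (j : Fin σ) :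
    Matrix.vecMul v (A.tiltedMatrix η σ p₀ σ₀ y) j = ∑ e : A.Edge η σ p₀,
      if e.target σ₀ = j then v e.source * ((e.N : ℝ) * Real.exp (y * e.D)) else 0 := by
  simp only [Matrix.vecMul, dotProduct, tiltedMatrix, Matrix.of_apply, Finset.mul_sum,
    Edge.endsAt_iff]
  rw [Finset.sum_comm]
  refine Finset.sum_congr rfl fun e _ => ?_
  rw [Finset.sum_eq_single e.source]
  · simp
  · intro i _ hi
    rw [if_neg (fun h => hi h.1.symm), mul_zero]
  · simp

/-- Split off the first `p₀` steps. They lead along an edge to `i + D`; undoing the shift of the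
state moves that site back by `σ₀`, to the residue class of the edge's target, and moves the test
function accordingly. -/
theorem weightedSum_step [NeZero σ] (hη : Function.Periodic η (σ : ℤ))
    (hs : A.ShiftsBy η p₀ σ₀) (y : ℝ)
    {g : ℤ → ℝ} (hg : Function.Periodic g (σ : ℤ)) (t : ℕ) (i : Fin σ) :
    A.weightedSum η y g (p₀ + t) (i : ℕ) = (A.tiltedMatrix η σ p₀ σ₀ y).mulVec
      (fun j => A.weightedSum η y (fun x => g (x + σ₀)) t (j : ℕ)) i := by
  rw [weightedSum_add, ← sum_edges_source i, tiltedMatrix_mulVec]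
  refine Finset.sum_congr rfl fun e _ => ?_
  split_ifs with h
  · subst h
    rw [weightedSum_of_shift (s := (σ₀ : ℤ)) hs]
    have hg' : Function.Periodic (fun x => g (x + σ₀)) (σ : ℤ) := fun x => by
      simp only [add_right_comm x _ (σ₀ : ℤ), hg (x + σ₀)]
    rw [periodic_modEq (weightedSum_periodic hη y hg' t) (residue_modEq _).symm]
    congr 3
    push_cast
    ring
  · rfl

theorem weightedSum_mul_add [NeZero σ] (hη : Function.Periodic η (σ : ℤ))
    (hs : A.ShiftsBy η p₀ σ₀) (y : ℝ)
    {g : ℤ → ℝ} (hg : Function.Periodic g (σ : ℤ)) (n r : ℕ) (i : Fin σ) :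
    A.weightedSum η y g (n * p₀ + r) (i : ℕ) = (A.tiltedMatrix η σ p₀ σ₀ y ^ n).mulVec
      (fun j => A.weightedSum η y (fun x => g (x + n * σ₀)) r (j : ℕ)) i := by
  induction n generalizing g i with
  | zero => simp
  | succ n ih =>
    have hg' : Function.Periodic (fun x => g (x + σ₀)) (σ : ℤ) := fun x => by
      simp only [add_right_comm x _ (σ₀ : ℤ), hg (x + σ₀)]
    rw [show (n + 1) * p₀ + r = p₀ + (n * p₀ + r) by ring, weightedSum_step hη hs y hg,
      pow_succ', ← Matrix.mulVec_mulVec]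
    congr 1
    funext j
    rw [ih hg']
    congr 1
    funext k
    congr 1
    funext x
    congr 1
    push_cast
    ring

theorem weightedSum_mul [NeZero σ] (hη : Function.Periodic η (σ : ℤ))
    (hs : A.ShiftsBy η p₀ σ₀) (y : ℝ)
    {g : ℤ → ℝ} (hg : Function.Periodic g (σ : ℤ)) (n : ℕ) (i : Fin σ) :
    A.weightedSum η y g (n * p₀) (i : ℕ) = (A.tiltedMatrix η σ p₀ σ₀ y ^ n).mulVec
      (fun j => g ((j : ℕ) + n * σ₀)) i := by
  rw [← add_zero (n * p₀), weightedSum_mul_add hη hs y hg n 0]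
  simp only [weightedSum_time_zero]

end BinaryCA

/-! ### Positivity patterns, comparison of positive vectors and growth rates. -/

namespace Matrix

theorem exists_pos_of_mul_apply_pos {n : Type*} [Fintype n] {M N : Matrix n n ℝ}
    (hM : ∀ i j, 0 ≤ M i j) (hN : ∀ i j, 0 ≤ N i j) {i j : n} (h : 0 < (M * N) i j) :
    ∃ k, 0 < M i k ∧ 0 < N k j := by
  obtain ⟨k, -, hk⟩ := Finset.exists_ne_zero_of_sum_ne_zero h.ne'
  exact ⟨k, (hM i k).lt_of_ne' (left_ne_zero_of_mul hk),
    (hN k j).lt_of_ne' (right_ne_zero_of_mul hk)⟩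

theorem mul_apply_pos {n : Type*} [Fintype n] {M N : Matrix n n ℝ}
    (hM : ∀ i j, 0 ≤ M i j) (hN : ∀ i j, 0 ≤ N i j) {i j k : n} (h1 : 0 < M i k) (h2 : 0 < N k j) :
    0 < (M * N) i j :=
  Finset.sum_pos' (fun l _ => mul_nonneg (hM i l) (hN l j)) ⟨k, Finset.mem_univ k, mul_pos h1 h2⟩

theorem pow_apply_pos_of_imp {n : Type*} [Fintype n] [DecidableEq n] {M N : Matrix n n ℝ}
    (hM : ∀ i j, 0 ≤ M i j) (hN : ∀ i j, 0 ≤ N i j) (h : ∀ i j, 0 < M i j → 0 < N i j) (k : ℕ)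
    {i j : n} (hk : 0 < (M ^ k) i j) : 0 < (N ^ k) i j := by
  induction k generalizing j with
  | zero => simpa using hk
  | succ k ih =>
    rw [pow_succ] at hk ⊢
    obtain ⟨l, h1, h2⟩ := exists_pos_of_mul_apply_pos (pow_apply_nonneg hM k) hM hk
    exact mul_apply_pos (pow_apply_nonneg hN k) hN (ih h1) (h _ _ h2)

theorem mulVec_mono {n : Type*} [Fintype n] {M : Matrix n n ℝ} (hM : ∀ i j, 0 ≤ M i j)
    {v w : n → ℝ} (h : ∀ i, v i ≤ w i) (i : n) : (M *ᵥ v) i ≤ (M *ᵥ w) i :=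
  Finset.sum_le_sum fun j _ => mul_le_mul_of_nonneg_left (h j) (hM i j)

end Matrix

/-- Positive vectors are comparable with a positive vector `h`, uniformly in finitely many of
them. -/
theorem exists_pos_bounds {ι n : Type*} [Finite ι] [Finite n] [Nonempty ι] [Nonempty n]
    {h : n → ℝ} (hh : ∀ i, 0 < h i) {u : ι → n → ℝ} (hu : ∀ r i, 0 < u r i) :
    ∃ c C : ℝ, 0 < c ∧ 0 < C ∧ ∀ r i, c * h i ≤ u r i ∧ u r i ≤ C * h i := by
  obtain ⟨q, hq⟩ := Finite.exists_min fun q : ι × n => u q.1 q.2 / h q.2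
  obtain ⟨s, hs⟩ := Finite.exists_max fun q : ι × n => u q.1 q.2 / h q.2
  exact ⟨_, _, div_pos (hu _ _) (hh _), div_pos (hu _ _) (hh _), fun r i =>
    ⟨(le_div_iff₀ (hh i)).1 (hq (r, i)), (div_le_iff₀ (hh i)).1 (hs (r, i))⟩⟩

/-- The exponential growth rate of a sequence that is comparable with `lam ^ (t / p)`. -/
theorem tendsto_log_div_of_bounds {f : ℕ → ℝ} {lam c C : ℝ} {p : ℕ} (hp : 0 < p) (hlam : 0 < lam)
    (hc : 0 < c) (hC : 0 < C) (h1 : ∀ t, c * lam ^ (t / p) ≤ f t)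
    (h2 : ∀ t, f t ≤ C * lam ^ (t / p)) :
    Tendsto (fun t : ℕ => Real.log (f t) / t) atTop (𝓝 (Real.log lam / p)) := by
  have h3 : Tendsto (fun t : ℕ => ((t / p : ℕ) : ℝ) / t) atTop (𝓝 (1 / p)) := by
    have h := (tendsto_nat_floor_mul_div_atTop (R := ℝ) (a := 1 / p) (by positivity)).comp
      tendsto_natCast_atTop_atTop
    refine h.congr fun t => ?_
    simp only [Function.comp_apply]
    rw [one_div_mul_eq_div, Nat.floor_div_eq_div]
  have h4 (a : ℝ) (ha : 0 < a) : Tendsto (fun t : ℕ => Real.log (a * lam ^ (t / p)) / t) atTop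
      (𝓝 (Real.log lam / p)) := by
    have h := (tendsto_const_div_atTop_nhds_zero_nat (Real.log a)).add (h3.const_mul (Real.log lam))
    rw [zero_add, mul_one_div] at h
    refine h.congr fun t => ?_
    rw [Real.log_mul ha.ne' (pow_pos hlam _).ne', Real.log_pow]
    ring
  refine tendsto_of_tendsto_of_tendsto_of_le_of_le (h4 c hc) (h4 C hC) (fun t => ?_) fun t => ?_
  · exact div_le_div_of_nonneg_right (Real.log_le_log (by positivity) (h1 t)) (Nat.cast_nonneg t)
  · exact div_le_div_of_nonneg_right
      (Real.log_le_log ((mul_pos hc (pow_pos hlam _)).trans_le (h1 t)) (h2 t)) (Nat.cast_nonneg t)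

namespace BinaryCA

variable {A : BinaryCA} {η : ℤ → Bool} {p σ p₀ σ₀ : ℕ}

/-! ### The temporal period is a multiple of the shift period -/

theorem ShiftsBy.iterate (hs : A.ShiftsBy η p₀ σ₀) (m : ℕ) (x : ℤ) :
    A.step^[m * p₀] η x = η (x - m * σ₀) := by
  induction m generalizing x with
  | zero => simp
  | succ m ih =>
    rw [show (m + 1) * p₀ = m * p₀ + p₀ by ring, Function.iterate_add_apply, funext hs,
      iterate_step_shift]
    simp only [ih]
    congr 1
    push_cast
    ring

/-- Otherwise the residue of `s` would be a positive period smaller than `σ`. -/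
theorem IsSpatialPeriod.dvd_of_sub_eq (hσ : IsSpatialPeriod η σ) {s : ℤ}
    (h : ∀ x, η (x - s) = η x) : (σ : ℤ) ∣ s := by
  have : NeZero σ := ⟨by have := hσ.1.1; omega⟩
  have hper := IsSpatialPeriod.periodic hσ.1.2
  have hr (x : ℤ) : η (x + (residue σ s : ℕ)) = η x := by
    rw [periodic_modEq hper ((residue_modEq s).add_left x), ← h (x + s), add_sub_cancel_right]
  by_cases h0 : (residue σ s : ℕ) = 0
  · have := residue_modEq (σ := σ) s
    rw [h0] at this
    exact (Int.modEq_zero_iff_dvd).1 this.symm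
  · have hle := hσ.2 ⟨Nat.one_le_iff_ne_zero.2 h0, fun x =>
      periodic_modEq (σ := (residue σ s : ℕ)) hr (Int.mod_modEq x _).symm⟩
    exact absurd (residue σ s).2 (not_lt.2 hle)

/-- This turns the kernel over a temporal period into an `m`-th power of the one over `p₀` steps,
with residue classes unmoved. A nonzero remainder `p % p₀` would itself be a time at which `η` is
shifted, by `-(m * σ₀)` modulo `σ`, against the minimality of `p₀`. -/
theorem IsShiftPeriod.exists_mul_eq (hp : A.IsTemporalPeriod η p) (hσ : IsSpatialPeriod η σ)
    (hp₀ : A.IsShiftPeriod η σ p₀ σ₀) : ∃ m : ℕ, p = m * p₀ ∧ (σ : ℤ) ∣ m * σ₀ := by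
  have : NeZero σ := ⟨by have := hσ.1.1; omega⟩
  obtain ⟨hleast, hlt, hs⟩ := hp₀
  have hper := IsSpatialPeriod.periodic hσ.1.2
  set m := p / p₀
  have hpr : p % p₀ + m * p₀ = p := by rw [mul_comm]; exact Nat.mod_add_div p p₀
  have h1 (x : ℤ) : A.step^[p % p₀] η (x - m * σ₀) = η x := by
    have h2 : A.step^[p] η x = η x := congrFun hp.1.2 x
    rw [← hpr, Function.iterate_add_apply, funext (hs.iterate m), iterate_step_shift] at h2
    exact h2
  have h0 : p % p₀ = 0 := by
    by_contra hne
    have hle := hleast.2 ⟨Nat.one_le_iff_ne_zero.2 hne, residue σ (-(m * σ₀ : ℤ)),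
      (residue σ _).2, fun x => ?_⟩
    · exact absurd (Nat.mod_lt p hleast.1.1) (not_lt.2 hle)
    · have h3 := h1 (x + m * σ₀)
      rw [add_sub_cancel_right] at h3
      rw [h3, periodic_modEq hper ((residue_modEq (-(m * σ₀ : ℤ))).sub_left x), sub_neg_eq_add]
  refine ⟨m, by omega, hσ.dvd_of_sub_eq fun x => ?_⟩
  rw [← h1 x, h0]
  rfl

/-! ### Irreducibility of the tilted vertex matrix -/

open Classical in
theorem tiltedMatrix_pow_apply [NeZero σ] (hη : Function.Periodic η (σ : ℤ))
    (hs : A.ShiftsBy η p₀ σ₀) (y : ℝ) {m : ℕ} (hm : (σ : ℤ) ∣ m * σ₀) (a b : Fin σ) :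
    (A.tiltedMatrix η σ p₀ σ₀ y ^ m) a b =
      A.weightedSum η y (fun x => if x ≡ (b : ℕ) [ZMOD σ] then 1 else 0) (m * p₀) (a : ℕ) := by
  rw [weightedSum_mul hη hs y _ m a]
  · rw [← Matrix.mulVec_single_one_eq (A.tiltedMatrix η σ p₀ σ₀ y ^ m) a b]
    congr 1
    funext j
    have h1 : ((j : ℕ) : ℤ) + m * σ₀ ≡ (j : ℕ) [ZMOD σ] := by
      simpa using (Int.modEq_zero_iff_dvd.2 hm).add_left ((j : ℕ) : ℤ)
    rw [Pi.single_apply]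
    refine if_congr ⟨?_, fun h => eq_of_natCast_modEq (h1.symm.trans h)⟩ rfl rfl
    rintro rfl
    exact h1
  · intro x
    refine if_congr ⟨fun h => ?_, fun h => ?_⟩ rfl rfl
    · exact (by simp [Int.ModEq] : x ≡ x + σ [ZMOD σ]).trans h
    · exact (by simp [Int.ModEq] : x + σ ≡ x [ZMOD σ]).trans h

/-- The `m`-th power of the tilted matrix is positive wherever `K` is, since exponential weights do
not affect positivity. -/
theorem tiltedMatrix_isIrreducible (hp : A.IsTemporalPeriod η p) (hσ : IsSpatialPeriod η σ)
    (hp₀ : A.IsShiftPeriod η σ p₀ σ₀) (hirr : (A.reducedKernel η p σ).IsIrreducible) (y : ℝ) :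
    (A.tiltedMatrix η σ p₀ σ₀ y).IsIrreducible := by
  have : NeZero σ := ⟨by have := hσ.1.1; omega⟩
  obtain ⟨m, hm, hd⟩ := hp₀.exists_mul_eq hp hσ
  have hm0 : 0 < m := Nat.pos_of_ne_zero fun h => by
    have := hp.1.1
    simp [hm, h] at this
  rw [Matrix.isIrreducible_iff_exists_pow_pos (tiltedMatrix_nonneg y)]
  intro i j
  obtain ⟨k, hk, hpos⟩ := (Matrix.isIrreducible_iff_exists_pow_pos hirr.nonneg).1 hirr i j
  refine ⟨m * k, Nat.mul_pos hm0 hk, ?_⟩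
  rw [pow_mul]
  refine Matrix.pow_apply_pos_of_imp hirr.nonneg
    (Matrix.pow_apply_nonneg (tiltedMatrix_nonneg y) m) (fun a b hab => ?_) k hpos
  rw [tiltedMatrix_pow_apply (IsSpatialPeriod.periodic hσ.1.2) hp₀.2.2 y hd,
    weightedSum_pos (fun x => by split_ifs <;> norm_num), ← hm]
  simp only [reducedKernel, Matrix.of_apply] at hab
  split_ifs at hab with hx
  · obtain ⟨x, hx, hd⟩ := hx
    exact ⟨x, by rw [if_pos hx]; norm_num, hd⟩
  · simp at hab

/-! ### The moment generating function of the defects -/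

open MassGrowth

theorem mgf_defects {Δ₀ : ℤ → ℕ} (hfin : Δ₀.support.Finite) (y : ℝ) (t : ℕ) :
    mgf (A.defects η Δ₀ t) y = ∑ a ∈ hfin.toFinset,
      Δ₀ a * Real.exp (y * a) * A.weightedSum η y (fun _ => 1) t a := by
  have h1 (x : ℤ) : (A.defects η Δ₀ t x : ℝ) * Real.exp (y * x) = ∑ a ∈ hfin.toFinset,
      Δ₀ a * Real.exp (y * a) * (1 * Real.exp (y * (x - a)) * A.defectsFrom η a t x) := by
    rw [A.defects_eq_sum η (F := hfin.toFinset) (by simp)]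
    push_cast
    rw [Finset.sum_mul]
    refine Finset.sum_congr rfl fun a _ => ?_
    rw [show y * (x : ℝ) = y * a + y * (x - a) by ring, Real.exp_add]
    ring
  rw [mgf, finsum_congr h1, finsum_sum_comm]
  · exact Finset.sum_congr rfl fun z _ => (mul_finsum _ _).symm
  · exact fun z _ => (weightedSum_support_finite (A := A) (η := η) y (fun _ => 1) t z).subset
      fun x hx h => hx (by simp only at h ⊢; rw [h, mul_zero])

/-- At multiples of `p₀` positivity follows from the eigenvector. Extinct defects never reappear, so
survival until `r * p₀ ≥ r` implies survival at time `r`. -/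
theorem weightedSum_one_pos [NeZero σ] (hη : Function.Periodic η (σ : ℤ))
    (hs : A.ShiftsBy η p₀ σ₀) (hp₀ : 0 < p₀) {y lam : ℝ} {h : Fin σ → ℝ} (hlam : 0 < lam)
    (hh : ∀ i, 0 < h i) (hr : (A.tiltedMatrix η σ p₀ σ₀ y).mulVec h = lam • h) (r : ℕ)
    (i : Fin σ) : 0 < A.weightedSum η y (fun _ => 1) r (i : ℕ) := by
  have h1 : 0 < A.weightedSum η y (fun _ => 1) (r * p₀) (i : ℕ) := by
    rw [weightedSum_mul hη hs y (fun _ => rfl)]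
    obtain ⟨j, hj⟩ := Finite.exists_max h
    have h2 := Matrix.mulVec_mono (M := A.tiltedMatrix η σ p₀ σ₀ y ^ r)
      (Matrix.pow_apply_nonneg (tiltedMatrix_nonneg y) r)
      (v := h) (w := h j • fun _ => 1) (fun i => by simpa using hj i) i
    rw [Matrix.mulVec_smul, Matrix.pow_mulVec_eq _ hr] at h2
    have h3 : 0 < h j * ((A.tiltedMatrix η σ p₀ σ₀ y ^ r).mulVec fun _ => 1) i :=
      (mul_pos (pow_pos hlam r) (hh i)).trans_le h2
    exact pos_of_mul_pos_right h3 (hh j).le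
  rw [weightedSum_pos fun _ => zero_le_one] at h1 ⊢
  by_contra! h2
  obtain ⟨x, -, hx⟩ := h1
  have h3 : A.defectsFrom η (i : ℕ) r = 0 := funext fun x => Nat.le_zero.1 (h2 x one_pos)
  obtain ⟨s, hs⟩ := Nat.exists_eq_add_of_le (Nat.le_mul_of_pos_right r hp₀)
  rw [defectsFrom, hs, defects_add] at hx
  rw [defectsFrom] at h3
  rw [h3, defects_zero] at hx
  exact lt_irrefl _ hx

/-- Write `t` as full blocks of length `p₀` plus a remainder. The finitely many remainder vectors
are positive, hence comparable with `h`, and each block multiplies `h` by `lam`. -/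
theorem exists_mgf_bounds [NeZero σ] (hη : Function.Periodic η (σ : ℤ))
    (hs : A.ShiftsBy η p₀ σ₀) (hp₀ : 0 < p₀) {y lam : ℝ} {h : Fin σ → ℝ} (hlam : 0 < lam)
    (hh : ∀ i, 0 < h i) (hr : (A.tiltedMatrix η σ p₀ σ₀ y).mulVec h = lam • h) {Δ₀ : ℤ → ℕ}
    (hΔ : IsInitialDefect Δ₀) :
    ∃ c C : ℝ, 0 < c ∧ 0 < C ∧ ∀ t, c * lam ^ (t / p₀) ≤ mgf (A.defects η Δ₀ t) y ∧
      mgf (A.defects η Δ₀ t) y ≤ C * lam ^ (t / p₀) := by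
  have : Nonempty (Fin p₀) := ⟨⟨0, hp₀⟩⟩
  obtain ⟨c, C, hc, hC, hcC⟩ := exists_pos_bounds hh
    (u := fun (r : Fin p₀) (i : Fin σ) => A.weightedSum η y (fun _ => 1) r (i : ℕ))
    fun r i => weightedSum_one_pos hη hs hp₀ hlam hh hr r i
  have hB := tiltedMatrix_nonneg (A := A) (η := η) (σ := σ) (p₀ := p₀) (σ₀ := σ₀) y
  have hw (t : ℕ) (a : ℤ) : c * lam ^ (t / p₀) * h (residue σ a) ≤
      A.weightedSum η y (fun _ => 1) t a ∧
      A.weightedSum η y (fun _ => 1) t a ≤ C * lam ^ (t / p₀) * h (residue σ a) := by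
    rw [periodic_modEq (weightedSum_periodic hη y (g := fun _ => 1) (fun _ => rfl) t)
      (residue_modEq a).symm]
    set i := residue σ a
    have h1 := weightedSum_mul_add hη hs y (g := fun _ => 1) (fun _ => rfl) (t / p₀) (t % p₀) i
    rw [mul_comm (t / p₀), Nat.div_add_mod] at h1
    rw [h1]
    have hb (j : Fin σ) := hcC ⟨t % p₀, Nat.mod_lt t hp₀⟩ j
    have hpow := Matrix.pow_mulVec_eq _ hr (t / p₀)
    constructor
    · have h2 := Matrix.mulVec_mono (Matrix.pow_apply_nonneg hB (t / p₀)) (v := c • h)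
        (fun j => (hb j).1) i
      rw [Matrix.mulVec_smul, hpow] at h2
      simpa [mul_assoc] using h2
    · have h2 := Matrix.mulVec_mono (Matrix.pow_apply_nonneg hB (t / p₀)) (w := C • h)
        (fun j => (hb j).2) i
      rw [Matrix.mulVec_smul, hpow] at h2
      simpa [mul_assoc] using h2
  set S := ∑ a ∈ hΔ.2.toFinset, (Δ₀ a : ℝ) * Real.exp (y * a) * h (residue σ a)
  have hS : 0 < S := by
    obtain ⟨a, ha⟩ := Function.ne_iff.1 hΔ.1
    refine Finset.sum_pos' (fun b _ => mul_nonneg (by positivity) (hh _).le)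
      ⟨a, by simpa using ha, mul_pos (mul_pos ?_ (Real.exp_pos _)) (hh _)⟩
    exact_mod_cast Nat.pos_of_ne_zero ha
  refine ⟨c * S, C * S, mul_pos hc hS, mul_pos hC hS, fun t => ?_⟩
  rw [mgf_defects hΔ.2, mul_right_comm, mul_right_comm C, Finset.mul_sum, Finset.mul_sum]
  constructor <;> refine Finset.sum_le_sum fun a _ => ?_
  · have := mul_le_mul_of_nonneg_left (hw t a).1
      (show 0 ≤ (Δ₀ a : ℝ) * Real.exp (y * a) by positivity)
    linarith
  · have := mul_le_mul_of_nonneg_left (hw t a).2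
      (show 0 ≤ (Δ₀ a : ℝ) * Real.exp (y * a) by positivity)
    linarith

theorem hasLogMgf_defects [NeZero σ] (hη : Function.Periodic η (σ : ℤ))
    (hs : A.ShiftsBy η p₀ σ₀) (hp₀ : 0 < p₀) {lam : ℝ → ℝ} {h : ℝ → Fin σ → ℝ}
    (hlam : ∀ y, 0 < lam y) (hh : ∀ y i, 0 < h y i)
    (hr : ∀ y, (A.tiltedMatrix η σ p₀ σ₀ y).mulVec (h y) = lam y • h y) {Δ₀ : ℤ → ℕ}
    (hΔ : IsInitialDefect Δ₀) :
    HasLogMgf (A.defects η Δ₀) fun y => Real.log (lam y) / p₀ where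
  finite := A.defects_support_finite η Δ₀ hΔ.2
  pos y t := by
    obtain ⟨c, C, hc, -, h⟩ := exists_mgf_bounds hη hs hp₀ (hlam y) (hh y) (hr y) hΔ
    exact (mul_pos hc (pow_pos (hlam y) _)).trans_le (h t).1
  tendsto y := by
    obtain ⟨c, C, hc, hC, h⟩ := exists_mgf_bounds hη hs hp₀ (hlam y) (hh y) (hr y) hΔ
    exact tendsto_log_div_of_bounds hp₀ (hlam y) hc hC (fun t => (h t).1) fun t => (h t).2

/-! ### The Lyapunov profile -/

section Profile

variable {Δ₀ : ℤ → ℕ} {G G' : ℝ → ℝ}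

theorem le_lowerLyapunovProfile (hm : HasLogMgf (A.defects η Δ₀) G)
    (hG : ∀ y, HasDerivAt G (G' y) y) (α : ℝ) :
    ⨅ y : ℝ, ((G y - y * α : ℝ) : EReal) ≤ A.lowerLyapunovProfile η Δ₀ α := by
  refine ge_of_tendsto (A.tendsto_lowerLyapunovProfile η Δ₀ α) ?_
  filter_upwards [self_mem_nhdsWithin] with ε hε
  -- `growth` unfolds to `windowGrowth` of the defect masses.
  exact hm.iInf_le_liminf_windowGrowth hG α hε

theorem lyapunovProfile_le (hm : HasLogMgf (A.defects η Δ₀) G) (α y : ℝ) :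
    A.lyapunovProfile η Δ₀ α ≤ ((G y - y * α : ℝ) : EReal) := by
  have h1 : Tendsto (fun ε : ℝ => ((G y - y * α + |y| * ε : ℝ) : EReal)) (𝓝[>] 0)
      (𝓝 ((G y - y * α : ℝ) : EReal)) := by
    refine (Continuous.tendsto' ?_ _ _ (by simp)).mono_left nhdsWithin_le_nhds
    exact continuous_coe_real_ereal.comp (by fun_prop)
  exact le_of_tendsto_of_tendsto' (A.tendsto_lyapunovProfile η Δ₀ α) h1
    fun ε => hm.limsup_windowGrowth_le α ε y

theorem lowerLyapunovProfile_le (Δ₀ : ℤ → ℕ) (α : ℝ) :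
    A.lowerLyapunovProfile η Δ₀ α ≤ A.lyapunovProfile η Δ₀ α :=
  le_of_tendsto_of_tendsto' (A.tendsto_lowerLyapunovProfile η Δ₀ α)
    (A.tendsto_lyapunovProfile η Δ₀ α) fun _ => liminf_le_limsup

theorem lyapunovProfile_eq (hm : HasLogMgf (A.defects η Δ₀) G)
    (hG : ∀ y, HasDerivAt G (G' y) y) (α : ℝ) :
    A.lyapunovProfile η Δ₀ α = ⨅ y : ℝ, ((G y - y * α : ℝ) : EReal) :=
  le_antisymm (le_iInf fun y => lyapunovProfile_le hm α y)
    ((le_lowerLyapunovProfile hm hG α).trans (lowerLyapunovProfile_le Δ₀ α))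

theorem isProper_of_hasLogMgf (hm : HasLogMgf (A.defects η Δ₀) G)
    (hG : ∀ y, HasDerivAt G (G' y) y) : A.IsProper η Δ₀ := fun α =>
  le_antisymm (lowerLyapunovProfile_le Δ₀ α)
    ((lyapunovProfile_eq hm hG α).le.trans (le_lowerLyapunovProfile hm hG α))

theorem lyapunovProfile_deriv_zero (hm : HasLogMgf (A.defects η Δ₀) G)
    (hG : ∀ y, HasDerivAt G (G' y) y) : A.lyapunovProfile η Δ₀ (G' 0) = (G 0 : EReal) := by
  refine le_antisymm (by simpa using lyapunovProfile_le hm (G' 0) 0) ?_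
  refine ge_of_tendsto (A.tendsto_lyapunovProfile η Δ₀ (G' 0)) ?_
  filter_upwards [self_mem_nhdsWithin] with ε hε
  have h := hm.le_liminf_windowGrowth (hG 0) hε
  rw [zero_mul, sub_zero] at h
  exact h.trans liminf_le_limsup

theorem isMLE_of_hasLogMgf (hm : HasLogMgf (A.defects η Δ₀) G)
    (hG : ∀ y, HasDerivAt G (G' y) y) : A.IsMLE η Δ₀ (G 0) := by
  refine ⟨⟨_, lyapunovProfile_deriv_zero hm hG⟩, ?_⟩
  rintro _ ⟨α, rfl⟩
  simpa using lyapunovProfile_le hm α 0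

/-- If `α` is a maximizer, the upper bound yields `G 0 ≤ G y - y * α` for all `y`, so `0` is a
critical point and `α` must be the slope there. -/
theorem isMLEDirection_iff (hm : HasLogMgf (A.defects η Δ₀) G)
    (hG : ∀ y, HasDerivAt G (G' y) y) (α : ℝ) : A.IsMLEDirection η Δ₀ α ↔ α = G' 0 := by
  constructor
  · intro h
    have h1 (y : ℝ) : G 0 ≤ G y - y * α := by
      have := (h (G' 0)).trans (lyapunovProfile_le hm α y)
      rw [lyapunovProfile_deriv_zero hm hG] at this
      exact_mod_cast this
    have h2 : HasDerivAt (fun y => G y - y * α) (G' 0 - α) 0 := by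
      exact ((hG 0).sub ((hasDerivAt_id (0 : ℝ)).mul_const α)).congr_deriv (by simp)
    have h3 := IsLocalMin.hasDerivAt_eq_zero
      (Eventually.of_forall fun y => by simpa using h1 y) h2
    linarith
  · rintro rfl β
    rw [lyapunovProfile_deriv_zero hm hG]
    simpa using lyapunovProfile_le hm β 0

end Profile

end BinaryCA

namespace BinaryCA

variable {A : BinaryCA} {η : ℤ → Bool} {p σ p₀ σ₀ : ℕ}

/-! ### The edge matrix -/

theorem edgeMatrix_nonneg (k l : A.Edge η σ p₀) : 0 ≤ A.edgeMatrix η σ p₀ σ₀ k l := by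
  simp only [edgeMatrix, Matrix.of_apply]
  split_ifs <;> positivity

theorem edgeMatrix_mul_weightMatrix_nonneg (y : ℝ) (k l : A.Edge η σ p₀) :
    0 ≤ (A.edgeMatrix η σ p₀ σ₀ * A.weightMatrix η σ p₀ y) k l := by
  rw [weightMatrix, Matrix.mul_diagonal]
  exact mul_nonneg (edgeMatrix_nonneg k l) (Real.exp_pos _).le

theorem edgeMatrix_mul_weightMatrix_zero :
    A.edgeMatrix η σ p₀ σ₀ * A.weightMatrix η σ p₀ 0 = A.edgeMatrix η σ p₀ σ₀ := by
  simp [weightMatrix]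

variable [NeZero σ]

theorem edgeMatrix_mul_weightMatrix_apply (y : ℝ) (k l : A.Edge η σ p₀) :
    (A.edgeMatrix η σ p₀ σ₀ * A.weightMatrix η σ p₀ y) k l =
      if l.source = k.target σ₀ then (k.N : ℝ) * Real.exp (y * l.D) else 0 := by
  rw [weightMatrix, Matrix.mul_diagonal]
  simp only [edgeMatrix, Matrix.of_apply, Edge.endsAt_iff, eq_comm (a := k.target σ₀), ite_mul,
    zero_mul]

/-- A positive right and left eigenvector of the tilted vertex matrix give positive right and left
eigenvectors of `T * W_y`. -/
theorem isPerronPair_edgeMatrix {y lam : ℝ} {h l : Fin σ → ℝ}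
    (hP : (A.tiltedMatrix η σ p₀ σ₀ y).IsPerronPair lam h l) :
    (A.edgeMatrix η σ p₀ σ₀ * A.weightMatrix η σ p₀ y).IsPerronPair lam
      (fun e => e.N * h (e.target σ₀)) (fun e => l e.source * Real.exp (y * e.D)) where
  pos := hP.pos
  right_pos e := mul_pos (by exact_mod_cast e.N_pos) (hP.right_pos _)
  left_pos e := mul_pos (hP.left_pos _) (Real.exp_pos _)
  right := by
    funext k
    have h1 := congrFun hP.right (k.target σ₀)
    rw [tiltedMatrix_mulVec, Pi.smul_apply, smul_eq_mul] at h1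
    simp only [Pi.smul_apply, smul_eq_mul]
    rw [mul_left_comm, ← h1, Finset.mul_sum]
    refine Finset.sum_congr rfl fun e _ => ?_
    beta_reduce
    rw [edgeMatrix_mul_weightMatrix_apply]
    split_ifs <;> ring
  left := by
    funext e
    have h1 := congrFun hP.left e.source
    rw [tiltedMatrix_vecMul, Pi.smul_apply, smul_eq_mul] at h1
    simp only [Pi.smul_apply, smul_eq_mul]
    rw [← mul_assoc, ← h1, Finset.sum_mul]
    refine Finset.sum_congr rfl fun k _ => ?_
    beta_reduce
    rw [edgeMatrix_mul_weightMatrix_apply]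
    simp only [eq_comm (a := e.source)]
    split_ifs <;> ring

/-- A path of edges from `k` to `l` carries the size of `k` but not that of `l`; between the target
of `k` and the source of `l` only `n` edges contribute. -/
theorem edgeMatrix_pow_succ_apply (n : ℕ) (k l : A.Edge η σ p₀) :
    (A.edgeMatrix η σ p₀ σ₀ ^ (n + 1)) k l =
      k.N * (A.tiltedMatrix η σ p₀ σ₀ 0 ^ n) (k.target σ₀) l.source := by
  induction n generalizing k with
  | zero =>
    rw [← edgeMatrix_mul_weightMatrix_zero, zero_add, pow_one, edgeMatrix_mul_weightMatrix_apply,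
      pow_zero, Matrix.one_apply]
    simp [eq_comm]
  | succ n ih =>
    have h1 : (A.tiltedMatrix η σ p₀ σ₀ 0 ^ (n + 1)) (k.target σ₀) l.source =
        (A.tiltedMatrix η σ p₀ σ₀ 0).mulVec
          (fun j => (A.tiltedMatrix η σ p₀ σ₀ 0 ^ n) j l.source) (k.target σ₀) := by
      rw [pow_succ', Matrix.mul_apply]
      rfl
    rw [pow_succ', Matrix.mul_apply, h1, tiltedMatrix_mulVec, Finset.mul_sum]
    refine Finset.sum_congr rfl fun e _ => ?_
    rw [ih, ← edgeMatrix_mul_weightMatrix_zero, edgeMatrix_mul_weightMatrix_apply]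
    split_ifs <;> simp

theorem edgeMatrix_isIrreducible (hB : (A.tiltedMatrix η σ p₀ σ₀ 0).IsIrreducible) :
    (A.edgeMatrix η σ p₀ σ₀).IsIrreducible := by
  rw [Matrix.isIrreducible_iff_exists_pow_pos edgeMatrix_nonneg]
  intro k l
  obtain ⟨n, -, hn⟩ :=
    (Matrix.isIrreducible_iff_exists_pow_pos hB.nonneg).1 hB (k.target σ₀) l.source
  refine ⟨n + 1, n.succ_pos, ?_⟩
  rw [edgeMatrix_pow_succ_apply]
  exact mul_pos (by exact_mod_cast k.N_pos) hn

theorem nonempty_edge {y lam : ℝ} {h l : Fin σ → ℝ}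
    (hP : (A.tiltedMatrix η σ p₀ σ₀ y).IsPerronPair lam h l) : Nonempty (A.Edge η σ p₀) := by
  by_contra hne
  rw [not_nonempty_iff] at hne
  have h1 := congrFun hP.right 0
  rw [tiltedMatrix_mulVec, Finset.univ_eq_empty, Finset.sum_empty] at h1
  exact (mul_pos hP.pos (hP.right_pos 0)).ne h1

/-! ### The derivative of the logarithmic spectral radius -/

open Classical in
theorem hasDerivAt_eigenvalue {lam : ℝ → ℝ} {h l : ℝ → Fin σ → ℝ}
    (hirr : ∀ y, (A.tiltedMatrix η σ p₀ σ₀ y).IsIrreducible)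
    (hP : ∀ y, (A.tiltedMatrix η σ p₀ σ₀ y).IsPerronPair (lam y) (h y) (l y)) (y : ℝ) :
    HasDerivAt lam ((∑ e : A.Edge η σ p₀,
      l y e.source * (e.N * (e.D * Real.exp (y * e.D)) * h y (e.target σ₀))) / l y ⬝ᵥ h y) y := by
  have h1 := Matrix.hasDerivAt_perron_eigenvalue (B := A.tiltedMatrix η σ p₀ σ₀)
    (B' := Matrix.of fun i j => ∑ e : A.Edge η σ p₀,
      if e.source = i ∧ e.EndsAt σ₀ j then (e.N : ℝ) * (e.D * Real.exp (y * e.D)) else 0)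
    (y₀ := y) (fun i j => ?_) (hirr y) hP
  · refine h1.congr_deriv ?_
    congr 1
    simp only [dotProduct, sum_edges_mulVec, Finset.mul_sum]
    rw [Finset.sum_comm]
    refine Finset.sum_congr rfl fun e _ => ?_
    simp
  · simp only [tiltedMatrix, Matrix.of_apply]
    refine HasDerivAt.fun_sum fun e _ => ?_
    split_ifs
    · refine HasDerivAt.const_mul _ ?_
      have h2 := ((hasDerivAt_id y).mul_const (e.D : ℝ)).exp
      refine h2.congr_deriv ?_
      simp [mul_comm]
    · exact hasDerivAt_const _ _

end BinaryCA

/-! ### The profile, the exponent and its direction from the Perron data. -/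

open BinaryCA Matrix in
theorem mainTheorem1 (A : BinaryCA) (η : ℤ → Bool) (p σ p₀ σ₀ : ℕ)
    (hp : A.IsTemporalPeriod η p) (hσ : BinaryCA.IsSpatialPeriod η σ)
    (hp₀ : A.IsShiftPeriod η σ p₀ σ₀)
    (hirr : (A.reducedKernel η p σ).IsIrreducible) :
    -- the profile is proper and independent of the initial defects
    (∀ Δ₀ : ℤ → ℕ, BinaryCA.IsInitialDefect Δ₀ → A.IsProper η Δ₀) ∧
    (∀ Δ₀ Δ₁ : ℤ → ℕ, BinaryCA.IsInitialDefect Δ₀ → BinaryCA.IsInitialDefect Δ₁ →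
      A.lyapunovProfile η Δ₀ = A.lyapunovProfile η Δ₁) ∧
    -- the spectral radii are positive, and the profile is a Legendre transform
    (∀ y : ℝ, 0 < BinaryCA.spr (A.edgeMatrix η σ p₀ σ₀ * A.weightMatrix η σ p₀ y)) ∧
    (∀ Δ₀ : ℤ → ℕ, BinaryCA.IsInitialDefect Δ₀ → ∀ α : ℝ,
      A.lyapunovProfile η Δ₀ α =
        ⨅ y : ℝ, ((-(y * α) + A.logSpr η σ p₀ σ₀ y / p₀ : ℝ) : EReal)) ∧
    -- the maximal Lyapunov exponent
    BinaryCA.spr (A.edgeMatrix η σ p₀ σ₀) ∈ spectrum ℝ (A.edgeMatrix η σ p₀ σ₀) ∧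
    BinaryCA.spr (A.vertexMatrix η σ p₀ σ₀) = BinaryCA.spr (A.edgeMatrix η σ p₀ σ₀) ∧
    (∀ Δ₀ : ℤ → ℕ, BinaryCA.IsInitialDefect Δ₀ →
      A.IsMLE η Δ₀ ((Real.log (BinaryCA.spr (A.vertexMatrix η σ p₀ σ₀)) / p₀ : ℝ) : EReal)) ∧
    -- the constants `c` and the unique MLE direction
    (∃ c : A.Edge η σ p₀ → ℝ,
      (∀ k, 0 < c k) ∧
      (∀ k, Tendsto (fun n : ℕ => (∑ m ∈ Finset.range n, (A.edgeMatrix η σ p₀ σ₀ ^ m) k k /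
          BinaryCA.spr (A.edgeMatrix η σ p₀ σ₀) ^ m) / (n : ℝ)) atTop (𝓝 (c k))) ∧
      ((A.edgeMatrix η σ p₀ σ₀).IsPrimitive → ∀ k,
        Asymptotics.IsEquivalent atTop (fun n : ℕ => (A.edgeMatrix η σ p₀ σ₀ ^ n) k k)
          (fun n : ℕ => c k * BinaryCA.spr (A.edgeMatrix η σ p₀ σ₀) ^ n)) ∧
      (∀ Δ₀ : ℤ → ℕ, BinaryCA.IsInitialDefect Δ₀ → ∀ α : ℝ,
        A.IsMLEDirection η Δ₀ α ↔ α = (∑ k, c k * (k.D : ℝ)) / p₀)) := by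
  have : NeZero σ := ⟨by have := hσ.1.1; omega⟩
  have hper := IsSpatialPeriod.periodic hσ.1.2
  have hp₀pos : 0 < p₀ := hp₀.1.1.1
  have hB := tiltedMatrix_isIrreducible hp hσ hp₀ hirr
  choose lam h l hP using fun y => (hB y).exists_isPerronPair
  have : Nonempty (A.Edge η σ p₀) := nonempty_edge (hP 0)
  have hspr (y : ℝ) : spr (A.edgeMatrix η σ p₀ σ₀ * A.weightMatrix η σ p₀ y) = lam y :=
    (isPerronPair_edgeMatrix (hP y)).spr_eq (edgeMatrix_mul_weightMatrix_nonneg y)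
  have hT := isPerronPair_edgeMatrix (hP 0)
  have hsprT := hspr 0
  rw [edgeMatrix_mul_weightMatrix_zero] at hT hsprT
  have hsprV : spr (A.vertexMatrix η σ p₀ σ₀) = lam 0 := by
    rw [← tiltedMatrix_zero]
    exact (hP 0).spr_eq (tiltedMatrix_nonneg 0)
  have hTirr := edgeMatrix_isIrreducible (hB 0)
  set r : A.Edge η σ p₀ → ℝ := fun e => e.N * h 0 (e.target σ₀) with hr
  set s : A.Edge η σ p₀ → ℝ := fun e => l 0 e.source * Real.exp (0 * e.D) with hs
  set G : ℝ → ℝ := fun y => Real.log (lam y) / p₀ with hGdef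
  have hlog (y : ℝ) : A.logSpr η σ p₀ σ₀ y / p₀ = G y := by rw [logSpr, hspr]
  have hm {Δ₀ : ℤ → ℕ} (hΔ : IsInitialDefect Δ₀) : MassGrowth.HasLogMgf (A.defects η Δ₀) G :=
    hasLogMgf_defects hper hp₀.2.2 hp₀pos (fun y => (hP y).pos) (fun y => (hP y).right_pos)
      (fun y => (hP y).right) hΔ
  have hG (y : ℝ) := ((hasDerivAt_eigenvalue hB hP y).log (hP y).pos.ne').div_const (p₀ : ℝ)
  set G' : ℝ → ℝ := fun y => (∑ e : A.Edge η σ p₀,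
    l y e.source * (e.N * (e.D * Real.exp (y * e.D)) * h y (e.target σ₀))) / l y ⬝ᵥ h y /
      lam y / p₀ with hG'
  have hlh := dotProduct_pos_of_pos (hP 0).left_pos (hP 0).right_pos
  -- `r k * s k` is the contribution of edge `k` to `l 0 ⬝ᵥ (B *ᵥ h 0)`, where `B` is the tilted
  -- matrix at `0`.
  have hsr : s ⬝ᵥ r = lam 0 * l 0 ⬝ᵥ h 0 := by
    rw [← smul_eq_mul, ← dotProduct_smul, ← (hP 0).right]
    simp only [dotProduct, tiltedMatrix_mulVec, Finset.mul_sum]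
    rw [Finset.sum_comm]
    refine Finset.sum_congr rfl fun e _ => ?_
    simp only [hs, hr, mul_ite, mul_zero, Finset.sum_ite_eq, Finset.mem_univ, if_true]
    ring
  -- Differentiating at `y = 0` multiplies the contribution of each edge by `D`; the factor `lam 0`
  -- from the logarithmic derivative is the one supplied by `hsr`.
  have hdir : (∑ k : A.Edge η σ p₀, r k * s k / s ⬝ᵥ r * (k.D : ℝ)) / p₀ = G' 0 := by
    simp only [hG']
    congr 1
    rw [div_div _ _ (lam 0), mul_comm _ (lam 0), ← hsr, Finset.sum_div]
    refine Finset.sum_congr rfl fun e _ => ?_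
    simp only [hs, hr]
    ring
  refine ⟨fun Δ₀ hΔ => isProper_of_hasLogMgf (hm hΔ) hG, fun Δ₀ Δ₁ h₀ h₁ => ?_,
    fun y => by rw [hspr]; exact (hP y).pos, fun Δ₀ hΔ α => ?_, ?_, hsprV.trans hsprT.symm,
    fun Δ₀ hΔ => ?_, fun k => r k * s k / s ⬝ᵥ r, fun k => ?_, fun k => ?_, fun hprim k => ?_,
    fun Δ₀ hΔ α => ?_⟩
  · funext α
    rw [lyapunovProfile_eq (hm h₀) hG, lyapunovProfile_eq (hm h₁) hG]
  · rw [lyapunovProfile_eq (hm hΔ) hG]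
    exact iInf_congr fun y => by rw [hlog, neg_add_eq_sub]
  · rw [hsprT]
    exact mem_spectrum_of_pos_eigenvector hT.right_pos hT.right
  · rw [hsprV]
    exact isMLE_of_hasLogMgf (hm hΔ) hG
  · exact div_pos (mul_pos (hT.right_pos k) (hT.left_pos k))
      (dotProduct_pos_of_pos hT.left_pos hT.right_pos)
  · rw [hsprT]
    exact hT.tendsto_cesaro hTirr k k
  · rw [hsprT]
    have hc : r k * s k / s ⬝ᵥ r ≠ 0 := (div_pos (mul_pos (hT.right_pos k) (hT.left_pos k))
      (dotProduct_pos_of_pos hT.left_pos hT.right_pos)).ne'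
    have h1 := (hT.tendsto_pow hprim k k).div_const (r k * s k / s ⬝ᵥ r)
    rw [div_self hc] at h1
    rw [Asymptotics.isEquivalent_iff_tendsto_one (Eventually.of_forall fun n =>
      mul_ne_zero hc (pow_pos hT.pos n).ne')]
    refine h1.congr fun n => ?_
    rw [Pi.div_apply, div_div, mul_comm (_ ^ n)]
  · rw [isMLEDirection_iff (hm hΔ) hG, hdir]
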